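/- Let $M$ be a smooth (Hausdorff) manifold of dimension $4n\ge 8$ with an almost hypercomplex structure $H=(J_1,J_2,J_3)$, i.e. smooth endomorphism fields of $TM$ with $$J_\alpha^2=-I,\qquad J_\alpha=J_\beta\circ J_\gamma=-J_\gamma\circ J_\beta$$ for all cyclic permutations $(\alpha,\beta,\gamma)$ of $(1,2,3)$. Let $g$ be a smooth pseudo-Riemannian metric on $M$ such that $(H,g)$ is an almost hypercomplex structure with Hermitian-Norden metrics, i.e. $$g(x,y)=\varepsilon_\alpha\, g(J_\alpha x,J_\alpha y),\qquad \varepsilon_1=1,\ \varepsilon_2=\varepsilon_3=-1,$$ and let $\mathrm D$ be the Levi-Civita connection of $g$. Assume that $(M,H,g)$ is quaternionic Kähler: every point of $M$ has an open neighbourhood on which there are smooth 1-forms $\omega_1,\omega_2,\omega_3$ with $$(\mathrm D_xJ_\alpha)y=\omega_\gamma(x)J_\beta y-\omega_\beta(x)J_\gamma y$$ for all cyclic permutations $(\alpha,\beta,\gamma)$ of $(1,2,3)$. Then $(M,g)$ is Einstein: the Ricci tensor $\rho(y,z)=g^{ij}\,g(R(e_i,y)z,e_j)$, where $R(x,y)z=\mathrm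 D_x\mathrm D_yz-\mathrm D_y\mathrm D_xz-\mathrm D_{[x,y]}z$, satisfies $\rho=\lambda g$ with a locally constant function $\lambda$ on $M$; in particular, if $M$ is connected, $\rho=\lambda g$ with a constant $\lambda\in\mathbb R$. -/

import Mathlib

open Bundle
open scoped Manifold ContDiff

noncomputable section

/-- A smooth pseudo-Riemannian metric on the manifold `M`: a smooth field of symmetric
nondegenerate bilinear forms on the tangent spaces. -/
structure PseudoRiemannianMetric {E H : Type*} [NormedAddCommGroup E] [NormedSpace ℝ E]
    [TopologicalSpace H] (I : ModelWithCorners ℝ E H) (M : Type*) [TopologicalSpace M]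
    [ChartedSpace H M] [IsManifold I ∞ M] where
  val (p : M) : TangentSpace I p →L[ℝ] TangentSpace I p →L[ℝ] ℝ
  symm (p : M) (u v : TangentSpace I p) : val p u v = val p v u
  nondegenerate (p : M) (u : TangentSpace I p) (hu : ∀ v, val p u v = 0) : u = 0
  contMDiff : ContMDiff I (I.prod 𝓘(ℝ, E →L[ℝ] E →L[ℝ] ℝ)) ∞
    (fun p ↦ TotalSpace.mk' (E →L[ℝ] E →L[ℝ] ℝ)
      (E := fun p : M ↦ TangentSpace I p →L[ℝ] TangentSpace I p →L[ℝ] ℝ) p (val p))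

/-- An almost hypercomplex structure `(J₁, J₂, J₃)` on `M`: a triple of smooth fields of
endomorphisms of the tangent spaces with `J_α² = -id` and `J_α = J_β ∘ J_γ = -J_γ ∘ J_β` for all
cyclic permutations `(α, β, γ)`. The indices `1, 2, 3` are `0, 1, 2 : Fin 3`, so that the cyclic
permutations are `(α, α + 1, α + 2)`. -/
structure AlmostHypercomplexStructure {E H : Type*} [NormedAddCommGroup E] [NormedSpace ℝ E]
    [TopologicalSpace H] (I : ModelWithCorners ℝ E H) (M : Type*) [TopologicalSpace M]
    [ChartedSpace H M] [IsManifold I ∞ M] where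
  J (α : Fin 3) (p : M) : TangentSpace I p →L[ℝ] TangentSpace I p
  contMDiff (α : Fin 3) : ContMDiff I (I.prod 𝓘(ℝ, E →L[ℝ] E)) ∞
    (fun p ↦ TotalSpace.mk' (E →L[ℝ] E)
      (E := fun p : M ↦ TangentSpace I p →L[ℝ] TangentSpace I p) p (J α p))
  sq (α : Fin 3) (p : M) (u : TangentSpace I p) : J α p (J α p u) = -u
  comp (α : Fin 3) (p : M) (u : TangentSpace I p) : J α p u = J (α + 1) p (J (α + 2) p u)
  comp_neg (α : Fin 3) (p : M) (u : TangentSpace I p) : J α p u = -J (α + 2) p (J (α + 1) p u)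

/-- The signs `ε₁ = 1`, `ε₂ = ε₃ = -1`. -/
def hnSign : Fin 3 → ℝ := ![1, -1, -1]

section Defs

variable {E H : Type*} [NormedAddCommGroup E] [NormedSpace ℝ E] [FiniteDimensional ℝ E]
  [TopologicalSpace H] {I : ModelWithCorners ℝ E H} {M : Type*} [TopologicalSpace M]
  [ChartedSpace H M] [IsManifold I ∞ M]

/-- `g` is a Hermitian-Norden metric for the almost hypercomplex structure `(J₁, J₂, J₃)`:
`g(x, y) = ε_α g(J_α x, J_α y)`. (In particular `g` has neutral signature, because `J₂` is an
anti-isometry.) -/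
def IsHermitianNorden (g : PseudoRiemannianMetric I M) (S : AlmostHypercomplexStructure I M) :
    Prop :=
  ∀ (α : Fin 3) (p : M) (u v : TangentSpace I p),
    g.val p u v = hnSign α * g.val p (S.J α p u) (S.J α p v)

/-- The affine connection `D` is the Levi-Civita connection of `g`: it is smooth, torsion-free,
and `D g = 0`. The vector `D Y p u` is the covariant derivative of `Y` in the direction
`u ∈ T_p M`. -/
structure IsLeviCivita (g : PseudoRiemannianMetric I M)
    (D : CovariantDerivative I E (TangentSpace I : M → Type _)) : Prop where
  smooth : ContMDiffCovariantDerivativeOn E ∞ D.toFun Set.univ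
  torsion_eq_zero : D.torsion = 0
  metric (p : M) (Y Z : Π q : M, TangentSpace I q)
    (hY : MDiffAt (T% Y) p) (hZ : MDiffAt (T% Z) p) (u : TangentSpace I p) :
    mvfderiv I (fun q ↦ g.val q (Y q) (Z q)) p u =
      g.val p (D Y p u) (Z p) + g.val p (Y p) (D Z p u)

/-- The structure `(J₁, J₂, J₃)` is quaternionic Kähler with respect to `D`: near each point there
are smooth local 1-forms `η₁, η₂, η₃` with `(D_x J_α) y = η_γ(x) J_β y - η_β(x) J_γ y` for all
cyclic permutations `(α, β, γ)`, where `(D_x J) y = D_x (J y) - J (D_x y)`. -/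
def IsQuaternionicKahler (D : CovariantDerivative I E (TangentSpace I : M → Type _))
    (S : AlmostHypercomplexStructure I M) : Prop :=
  ∀ p₀ : M, ∃ U : Set M, IsOpen U ∧ p₀ ∈ U ∧
    ∃ η : Fin 3 → Π p : M, TangentSpace I p →L[ℝ] ℝ,
      (∀ α, ContMDiffOn I (I.prod 𝓘(ℝ, E →L[ℝ] ℝ)) ∞
        (fun p ↦ TotalSpace.mk' (E →L[ℝ] ℝ)
          (E := fun p : M ↦ TangentSpace I p →L[ℝ] ℝ) p (η α p)) U) ∧
      ∀ (α : Fin 3), ∀ p ∈ U, ∀ (Y : Π q : M, TangentSpace I q), MDiffAt (T% Y) p →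
        ∀ u : TangentSpace I p,
          D (fun q ↦ S.J α q (Y q)) p u - S.J α p (D Y p u) =
            η (α + 2) p u • S.J (α + 1) p (Y p) - η (α + 1) p u • S.J (α + 2) p (Y p)

/-- The curvature `R(u, v)w = D_X D_Y Z - D_Y D_X Z - D_{[X, Y]} Z` at `p`, where `X, Y, Z` are
vector fields, smooth near `p`, that extend `u, v, w`. -/
def curvature (D : CovariantDerivative I E (TangentSpace I : M → Type _)) (p : M)
    (u v w : TangentSpace I p) : TangentSpace I p :=
  let X : Π q : M, TangentSpace I q := FiberBundle.extend E u
  let Y : Π q : M, TangentSpace I q := FiberBundle.extend E v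
  let Z : Π q : M, TangentSpace I q := FiberBundle.extend E w
  D (fun q ↦ D Z q (Y q)) p (X p) - D (fun q ↦ D Z q (X q)) p (Y p)
    - D Z p (VectorField.mlieBracket I X Y p)

/-- The Ricci tensor `ρ(y, z) = g^{ij} g(R(e_i, y)z, e_j)`, where `(e_i)` is a basis of `T_p M`
and `(g^{ij})` is the inverse of the matrix `(g(e_i, e_j))`. -/
def ricci (g : PseudoRiemannianMetric I M)
    (D : CovariantDerivative I E (TangentSpace I : M → Type _)) (p : M)
    (y z : TangentSpace I p) : ℝ :=
  haveI : FiniteDimensional ℝ (TangentSpace I p) := inferInstanceAs (FiniteDimensional ℝ E)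
  let e := Module.finBasis ℝ (TangentSpace I p)
  let G := Matrix.of fun i j ↦ g.val p (e i) (e j)
  ∑ i, ∑ j, G⁻¹ i j * g.val p (curvature D p (e i) y z) (e j)

end Defs

end

/-! Write I, J, K for `J 0`, `J 1`, `J 2`, and let 4N be the dimension. The metric makes I skew and
J, K symmetric. Since `g` is parallel, D I is again skew; but the quaternionic Kähler condition
writes D I as a combination of J and K, which is symmetric. Hence D I = 0 and the forms `η 1`, `η 2`
vanish. With η = `η 0` there remain D J = η K and D K = -η J, so the curvature commutes with I and
satisfies [R(x, y), J] = Ω(x, y) K, where Ω = dη.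

The Einstein condition at a point is then algebra (`exists_ricci_eq_smul_of_commutator`). The trace
of K R(a, b) J and the Bianchi identity give ρ(b, I a) = -N Ω(a, b). Evaluating ρ(J y, J z) directly
gives a second relation, and the two together yield (N - 1)(ρ(J y, J z) + ρ(y, z)) = 0. As N ≥ 2, ρ
changes sign under J and Ω is J-invariant. Pair symmetry of R now forces Ω = μ F with F = g(I ·, ·),
and ρ = -N μ g follows.

That μ is locally constant is a Schur argument. F is closed because I and `g` are parallel and the
torsion vanishes, and Ω is closed because it is exact. So dμ ∧ F = 0, and dμ = 0 because F is
nondegenerate in dimension at least three (`eq_zero_of_wedge_nondegenerate`).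

The differential part is carried out in a chart, on the data of `IsCoordQuaternionicKahler`; the
passage from the manifold is `isCoordQuaternionicKahler`, `ricci_eq_trace` and
`exteriorDerivative_coordFrame`. -/

/-! ### Traces against a metric, and symmetries of curvature tensors -/

/-- The contraction of the `g`-lowered form of an endomorphism with the inverse Gram matrix of `g`
is its trace. -/
theorem sum_gram_inv_mul_eq_trace {V : Type*} [AddCommGroup V] [Module ℝ V]
    {ι : Type*} [Fintype ι] [DecidableEq ι] (e : Module.Basis ι ℝ V)
    (g : V →ₗ[ℝ] V →ₗ[ℝ] ℝ) (hsymm : ∀ u v, g u v = g v u)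
    (hnd : ∀ u, (∀ v, g u v = 0) → u = 0) (T : V →ₗ[ℝ] V) :
    ∑ i, ∑ j, (Matrix.of fun i j ↦ g (e i) (e j))⁻¹ i j * g (T (e i)) (e j) =
      LinearMap.trace ℝ V T := by
  set G : Matrix ι ι ℝ := Matrix.of fun i j ↦ g (e i) (e j) with hG
  -- A vector in the left kernel of the Gram matrix is the coordinate vector of an element
  -- orthogonal to everything.
  have hdet : IsUnit G.det := by
    rw [isUnit_iff_ne_zero]
    intro h0
    obtain ⟨v, hv, hv0⟩ := Matrix.exists_vecMul_eq_zero_iff.mpr h0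
    apply hv
    have hz : ∑ i, v i • e i = 0 := by
      apply hnd
      intro w
      have : g (∑ i, v i • e i) = 0 := by
        refine e.ext fun j ↦ ?_
        have := congrFun hv0 j
        simpa [Matrix.vecMul, dotProduct, hG] using this
      rw [this]; rfl
    funext i
    exact Fintype.linearIndependent_iff.mp e.linearIndependent v hz i
  have hT (i j : ι) : g (T (e i)) (e j) = ∑ k, LinearMap.toMatrix e e T k i * G k j := by
    have h := congrArg (fun u ↦ g u (e j)) (e.sum_repr (T (e i)))
    simp only [map_sum, map_smul, LinearMap.sum_apply, LinearMap.smul_apply, smul_eq_mul] at h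
    simp [hG, LinearMap.toMatrix_apply, ← h]
  have hGs : ∀ i j, G i j = G j i := fun i j ↦ hsymm _ _
  rw [LinearMap.trace_eq_matrix_trace ℝ e, Matrix.trace]
  refine Finset.sum_congr rfl fun i _ ↦ ?_
  have h1 (k : ι) : ∑ j, G⁻¹ i j * G k j = (1 : Matrix ι ι ℝ) i k := by
    rw [← Matrix.nonsing_inv_mul G hdet, Matrix.mul_apply]
    exact Finset.sum_congr rfl fun j _ ↦ by rw [hGs k j]
  calc ∑ j, G⁻¹ i j * g (T (e i)) (e j)
      = ∑ j, ∑ k, LinearMap.toMatrix e e T k i * (G⁻¹ i j * G k j) := by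
        refine Finset.sum_congr rfl fun j _ ↦ ?_
        rw [hT, Finset.mul_sum]
        exact Finset.sum_congr rfl fun k _ ↦ by ring
    _ = ∑ k, LinearMap.toMatrix e e T k i * ∑ j, G⁻¹ i j * G k j := by
        rw [Finset.sum_comm]
        exact Finset.sum_congr rfl fun k _ ↦ by rw [Finset.mul_sum]
    _ = (LinearMap.toMatrix e e T).diag i := by
        simp [h1, Matrix.one_apply]

/-- Endomorphisms that are adjoint with respect to a nondegenerate bilinear form have the same
trace. -/
theorem trace_eq_trace_of_adjoint {V : Type*} [AddCommGroup V] [Module ℝ V]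
    [FiniteDimensional ℝ V]
    (g : V →ₗ[ℝ] V →ₗ[ℝ] ℝ) (hsymm : ∀ u v, g u v = g v u)
    (hnd : ∀ u, (∀ v, g u v = 0) → u = 0) (T T' : V →ₗ[ℝ] V)
    (h : ∀ x w, g (T x) w = g x (T' w)) :
    LinearMap.trace ℝ V T = LinearMap.trace ℝ V T' := by
  classical
  let e := Module.finBasis ℝ V
  rw [← sum_gram_inv_mul_eq_trace e g hsymm hnd T, ← sum_gram_inv_mul_eq_trace e g hsymm hnd T',
    Finset.sum_comm]
  have hs : (Matrix.of fun i j ↦ g (e i) (e j))⁻¹.transpose =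
      (Matrix.of fun i j ↦ g (e i) (e j))⁻¹ := by
    rw [Matrix.transpose_nonsing_inv]
    congr 1
    ext i j
    exact hsymm _ _
  refine Finset.sum_congr rfl fun i _ ↦ Finset.sum_congr rfl fun j _ ↦ ?_
  rw [h, hsymm, ← Matrix.transpose_apply (_)⁻¹ i j, hs]

/-- A skew curvature-like tensor that satisfies the first Bianchi identity is symmetric under
exchange of pairs. -/
theorem pair_symm_of_bianchi {V : Type*} (r : V → V → V → V → ℝ)
    (h12 : ∀ a b c d, r a b c d = -r b a c d) (h34 : ∀ a b c d, r a b c d = -r a b d c)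
    (hB : ∀ a b c d, r a b c d + r b c a d + r c a b d = 0) (a b c d : V) :
    r a b c d = r c d a b := by
  -- The classical octahedron argument: the Bianchi identities for the four cyclic shifts of the
  -- arguments are combined by means of the two skew-symmetries.
  linarith [hB a b c d, hB b c d a, hB c d a b, hB d a b c, h12 a b c d, h34 a b c d,
    h12 b c a d, h34 b c a d, h12 c a b d, h34 c a b d, h12 b c d a, h34 b c d a, h12 c d b a,
    h34 c d b a, h12 d b c a, h34 d b c a, h12 c d a b, h34 c d a b, h12 d a c b, h34 d a c b,
    h12 a c d b, h34 a c d b, h12 d a b c, h34 d a b c, h12 a b d c, h34 a b d c, h12 b d a c,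
    h34 b d a c]

/-! ### Pointwise algebra: the commutator relations imply the Einstein condition -/

section Algebra

variable {V : Type*} [AddCommGroup V] [Module ℝ V] [FiniteDimensional ℝ V]

/-- The pointwise algebra of a hypercomplex structure `I = JK` with a metric for which `I` is skew
and `J` is symmetric: a curvature tensor `R` that commutes with `I` and satisfies
`[R(x, y), J] = Ω(x, y) K` has `Ω = μ g(I ·, ·)` and its Ricci tensor is `-(dim V / 4) μ g`. -/
theorem exists_ricci_eq_smul_of_commutator (g : V →ₗ[ℝ] V →ₗ[ℝ] ℝ)
    (hsymm : ∀ u v, g u v = g v u) (hnd : ∀ u, (∀ v, g u v = 0) → u = 0)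
    (I J K : V →ₗ[ℝ] V) (hII : ∀ u, I (I u) = -u) (hJJ : ∀ u, J (J u) = -u)
    (hKK : ∀ u, K (K u) = -u) (hJK : ∀ u, J (K u) = I u) (hKJ : ∀ u, K (J u) = -I u)
    (hIJ : ∀ u, I (J u) = K u) (hJI : ∀ u, J (I u) = -K u)
    (hIK : ∀ u, I (K u) = -J u)
    (hgI : ∀ u v, g (I u) v = -g u (I v)) (hgJ : ∀ u v, g (J u) v = g u (J v))
    (R : V →ₗ[ℝ] V →ₗ[ℝ] V →ₗ[ℝ] V) (Ω : V →ₗ[ℝ] V →ₗ[ℝ] ℝ)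
    (hR : ∀ a b c, R a b c = -R b a c)
    (hRg : ∀ a b c d, g (R a b c) d = -g c (R a b d))
    (hB : ∀ a b c, R a b c + R b c a + R c a b = 0)
    (hRI : ∀ a b c, R a b (I c) = I (R a b c))
    (hRJ : ∀ a b c, R a b (J c) = J (R a b c) + Ω a b • K c)
    (hdim : 8 ≤ Module.finrank ℝ V) :
    ∃ μ : ℝ, (∀ a b, Ω a b = μ * g (I a) b) ∧ ∀ y z,
      LinearMap.trace ℝ V ((R.flip y).flip z) = -(Module.finrank ℝ V / 4 : ℝ) * μ * g y z := by
  set N : ℝ := (Module.finrank ℝ V / 4 : ℝ) with hN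
  have hN2 : (2 : ℝ) ≤ N := by
    have : (8 : ℝ) ≤ Module.finrank ℝ V := by exact_mod_cast hdim
    linarith
  have hext {u v : V} (h : ∀ w, g u w = g v w) : u = v :=
    sub_eq_zero.mp (hnd _ fun w ↦ by simp [h w])
  have hpair (a b c d : V) : g (R a b c) d = g (R c d a) b :=
    pair_symm_of_bianchi (fun a b c d ↦ g (R a b c) d)
      (fun a b c d ↦ by simp [hR a b c]) (fun a b c d ↦ by rw [hRg, hsymm])
      (fun a b c d ↦ by
        have := congrArg (fun u ↦ g u d) (hB a b c)
        simpa using this) a b c d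
  have hRII (a b c : V) : R (I a) (I b) c = R a b c := by
    refine hext fun d ↦ ?_
    rw [hpair, hRI, hgI, hII, hpair a b]
    simp
  have hRIr (a b c : V) : R a (I b) c = -R (I a) b c := by
    rw [← hRII a (I b) c, hII]
    simp
  -- Pairing [R(x, y), J] z = Ω(x, y) K z with J w: J is symmetric with square -1, and J K = I.
  have hstar (x y z w : V) :
      g (R x y z) w + g (R x y (J z)) (J w) = Ω x y * g (I z) w := by
    rw [hRJ, map_add, LinearMap.add_apply, map_smul, LinearMap.smul_apply, hgJ, hJJ, ← hgJ, hJK]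
    simp
  have hstar' (x y z w : V) :
      g (R x y z) w + g (R (J x) (J y) z) w = Ω z w * g (I x) y := by
    rw [hpair x y, hpair (J x) (J y), hstar]
  let ρ (y z : V) : ℝ := LinearMap.trace ℝ V ((R.flip y).flip z)
  have hρ (y z : V) : LinearMap.trace ℝ V ((R.flip y).flip z) = ρ y z := rfl
  have hρsymm (y z : V) : ρ y z = ρ z y := by
    refine trace_eq_trace_of_adjoint g hsymm hnd _ _ fun x w ↦ ?_
    simp only [LinearMap.flip_apply]
    rw [hpair, hR, map_neg, LinearMap.neg_apply, hRg, neg_neg]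
  -- The endomorphism for (I y, I z) is the one for (y, z) conjugated by I.
  have hρI (y z : V) : ρ (I y) (I z) = ρ y z := by
    have : (R.flip (I y)).flip (I z) = -(I ∘ₗ ((R.flip y).flip z ∘ₗ I)) := by
      ext x
      simp [hRI, hRIr]
    simp only [ρ]
    rw [this, map_neg, LinearMap.trace_comp_comm', LinearMap.comp_assoc]
    have h2 : I ∘ₗ I = -LinearMap.id := by ext x; simp [hII]
    rw [h2]
    simp
  -- The trace of K R(a, b) J is evaluated twice: cyclicity and J K = I give tr(I R(a, b)), while
  -- moving J past R and using K J = -I gives -tr(I R(a, b)) - 4N Ω(a, b).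
  have htrI (a b : V) : LinearMap.trace ℝ V (I ∘ₗ R a b) = -2 * N * Ω a b := by
    have h1 : K ∘ₗ (R a b ∘ₗ J) = K ∘ₗ (J ∘ₗ R a b) - Ω a b • LinearMap.id := by
      ext x
      simp [hRJ, hKK, sub_eq_add_neg]
    have h2 : LinearMap.trace ℝ V (K ∘ₗ (R a b ∘ₗ J)) = LinearMap.trace ℝ V (I ∘ₗ R a b) := by
      rw [← LinearMap.comp_assoc, LinearMap.trace_comp_comm', ← LinearMap.comp_assoc]
      congr 2
      ext x
      simp [hJK]
    have h3 : K ∘ₗ (J ∘ₗ R a b) = -(I ∘ₗ R a b) := by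
      ext x
      simp [hKJ]
    have h4 := congrArg (LinearMap.trace ℝ V) h1
    rw [h2, h3, map_sub, map_neg, map_smul, LinearMap.trace_id, smul_eq_mul] at h4
    rw [hN]
    linarith
  -- Bianchi writes I R(a, b) as a difference of two Ricci endomorphisms, and I-invariance of ρ
  -- makes their traces opposite.
  have hρΩ (a b : V) : ρ b (I a) = -N * Ω a b := by
    have h1 : I ∘ₗ R a b = (R.flip b).flip (I a) - (R.flip a).flip (I b) := by
      ext x
      have := hB a b x
      have h2 : R a b x = R x b a - R x a b := by
        rw [hR x b a]
        rw [← sub_eq_zero, ← this, hR b x a]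
        abel
      simp [hRI, h2]
    have h2 := congrArg (LinearMap.trace ℝ V) h1
    rw [htrI, map_sub, hρ, hρ, ← hρI a (I b), hII] at h2
    have h3 : ρ (I a) (-b) = -ρ b (I a) := by
      rw [hρsymm b]
      simp [ρ]
    rw [h3] at h2
    linarith
  have hρJ (y z : V) : ρ (J y) (J z) = -ρ y z - Ω z (I y) + Ω (K z) (J y) := by
    -- The metric dual of Ω(z, ·) exhibits the correction term in `hstar'` as a rank-one
    -- endomorphism, whose trace is explicit.
    obtain ⟨s, hs⟩ : ∃ s, ∀ w, g s w = Ω z w := by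
      have hinj : Function.Injective g := fun u v h ↦ hext fun w ↦ by rw [h]
      obtain ⟨s, hs⟩ := (LinearMap.injective_iff_surjective_of_finrank_eq_finrank
        (f := g) (Subspace.dual_finrank_eq).symm).mp hinj (Ω z)
      exact ⟨s, fun w ↦ by rw [hs]⟩
    have h1 : (R.flip (J y)).flip (J z) =
        J ∘ₗ ((R.flip (J y)).flip z) + (Ω.flip (J y)).smulRight (K z) := by
      ext x
      simp [hRJ]
    have h2 : (R.flip (J y)).flip z ∘ₗ J =
        -(R.flip y).flip z + ((g.flip y) ∘ₗ I).smulRight s := by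
      ext x
      refine hext fun w ↦ ?_
      have := hstar' x y z w
      simp [hs]
      linarith
    simp only [ρ]
    rw [h1, map_add, LinearMap.trace_comp_comm', h2]
    simp [LinearMap.trace_smulRight, hgI, hs]
    ring
  have hρJ' (y z : V) : ρ (J y) (J z) = -ρ y z := by
    have h1 := hρΩ z (I y)
    rw [hρI] at h1
    have h2 := hρΩ (K z) (J y)
    rw [hIK] at h2
    have h3 : ρ (J y) (-J z) = -ρ (J y) (J z) := by simp [ρ]
    rw [h3] at h2
    have h4 := hρJ y z
    -- By `hρΩ` both Ω-terms of `hρJ` are Ricci terms divided by N. Dimension at least 8 is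
    -- essential here: for N = 1 the relation is empty.
    have : (N - 1) * (ρ (J y) (J z) + ρ y z) = 0 := by
      linear_combination N * h4 + h2 - h1
    rcases mul_eq_zero.mp this with h | h <;> linarith
  have hΩJ (a b : V) : Ω (J a) (J b) = Ω a b := by
    have h1 := hρΩ (J a) (J b)
    rw [hIJ] at h1
    have h2 := hρJ' b (I a)
    rw [hJI] at h2
    have h3 : ρ (J b) (-K a) = -ρ (J b) (K a) := by simp [ρ]
    rw [h3, hρΩ, h1] at h2
    have : N * (Ω (J a) (J b) - Ω a b) = 0 := by linarith
    rcases mul_eq_zero.mp this with h | h <;> linarith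
  -- Both sides are half the sum of g(R z, w) over the four ways of applying or not applying J to
  -- the pairs (x, y) and (z, w); `hstar` and `hstar'` group these terms differently.
  have hprop (x y z w : V) : Ω x y * g (I z) w = Ω z w * g (I x) y := by
    have h1 := hstar x y z w
    have h2 := hstar (J x) (J y) z w
    have h3 := hstar' x y z w
    have h4 := hstar' x y (J z) (J w)
    rw [hΩJ] at h2 h4
    linarith
  obtain ⟨z, hz⟩ : ∃ z : V, z ≠ 0 := by
    have : Nontrivial V := Module.nontrivial_of_finrank_pos (R := ℝ) (by omega)
    exact exists_ne 0
  obtain ⟨w, hw⟩ : ∃ w, g (I z) w ≠ 0 := by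
    by_contra! h
    have := hII z
    rw [hnd _ h, map_zero] at this
    exact hz (neg_eq_zero.mp this.symm)
  have hμ (a b : V) : Ω a b = Ω z w / g (I z) w * g (I a) b := by
    rw [div_mul_eq_mul_div, eq_div_iff hw, hprop a b z w]
  refine ⟨Ω z w / g (I z) w, hμ, fun y z' ↦ ?_⟩
  have h1 := hρΩ (I z') y
  rw [hII, hμ, hII] at h1
  have h3 : ρ y (-z') = -ρ y z' := by simp [ρ]
  rw [h3] at h1
  rw [hρ, hsymm y z']
  have : g (-z') y = - g z' y := by simp
  rw [this] at h1
  linarith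

end Algebra

/-! ### Differential geometry of the structure in one chart -/

section Coordinates

open Filter Topology

variable {E : Type*} [NormedAddCommGroup E] [NormedSpace ℝ E]

/-- The covariant derivative `∂_a z + Γ(a, z)` of a vector-valued function `z` for the Christoffel
symbols `Γ`. -/
noncomputable def coordCovDeriv (Γ : E → E →L[ℝ] E →L[ℝ] E) (z : E → E) (x a : E) : E :=
  fderiv ℝ z x a + Γ x a (z x)

set_option synthInstance.maxHeartbeats 200000

/-- Auxiliary bilinear expression `∂_a Γ_b + Γ_a Γ_b`. -/
noncomputable def coordCurvatureAux (Γ : E → E →L[ℝ] E →L[ℝ] E) (x : E) : E →L[ℝ] E →L[ℝ] E →L[ℝ] E :=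
  fderiv ℝ Γ x + (ContinuousLinearMap.compL ℝ E E E).bilinearComp (Γ x) (Γ x)

/-- The curvature `∂_a Γ_b - ∂_b Γ_a + [Γ_a, Γ_b]` of the Christoffel symbols `Γ`. -/
noncomputable def coordCurvature (Γ : E → E →L[ℝ] E →L[ℝ] E) (x : E) : E →L[ℝ] E →L[ℝ] E →L[ℝ] E :=
  coordCurvatureAux Γ x - (coordCurvatureAux Γ x).flip

theorem coordCurvature_apply (Γ : E → E →L[ℝ] E →L[ℝ] E) (x a b c : E) :
    coordCurvature Γ x a b c = fderiv ℝ Γ x a b c + Γ x a (Γ x b c)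
      - (fderiv ℝ Γ x b a c + Γ x b (Γ x a c)) := by
  simp [coordCurvature, coordCurvatureAux]

theorem fderiv_fderiv_comm {F : Type*} [NormedAddCommGroup F] [NormedSpace ℝ F] {f : E → F} {x : E}
    (hf : ContDiffAt ℝ 2 f x) (a b : E) :
    fderiv ℝ (fun y ↦ fderiv ℝ f y b) x a = fderiv ℝ (fun y ↦ fderiv ℝ f y a) x b := by
  have hd : DifferentiableAt ℝ (fderiv ℝ f) x :=
    (hf.fderiv_right (m := 1) (by norm_num)).differentiableAt (by norm_num)
  rw [fderiv_clm_apply hd (differentiableAt_const _), fderiv_clm_apply hd (differentiableAt_const _)]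
  simpa using (hf.isSymmSndFDerivAt (by simp)) a b

theorem coordCovDeriv_const (Γ : E → E →L[ℝ] E →L[ℝ] E) (x a c : E) :
    coordCovDeriv Γ (fun _ ↦ c) x a = Γ x a c := by
  simp [coordCovDeriv]

theorem coordCovDeriv_congr (Γ : E → E →L[ℝ] E →L[ℝ] E) {z z' : E → E} {x : E} (h : z =ᶠ[𝓝 x] z')
    (a : E) : coordCovDeriv Γ z x a = coordCovDeriv Γ z' x a := by
  simp [coordCovDeriv, h.fderiv_eq, h.eq_of_nhds]

theorem coordCovDeriv_add (Γ : E → E →L[ℝ] E →L[ℝ] E) {z z' : E → E} {x : E}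
    (hz : DifferentiableAt ℝ z x) (hz' : DifferentiableAt ℝ z' x) (a : E) :
    coordCovDeriv Γ (fun y ↦ z y + z' y) x a =
      coordCovDeriv Γ z x a + coordCovDeriv Γ z' x a := by
  simp only [coordCovDeriv, fderiv_fun_add hz hz', add_apply, map_add]
  abel

theorem coordCovDeriv_smul (Γ : E → E →L[ℝ] E →L[ℝ] E) {f : E → ℝ} {z : E → E} {x : E}
    (hf : DifferentiableAt ℝ f x) (hz : DifferentiableAt ℝ z x) (a : E) :
    coordCovDeriv Γ (fun y ↦ f y • z y) x a =
      f x • coordCovDeriv Γ z x a + fderiv ℝ f x a • z x := by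
  simp only [coordCovDeriv, fderiv_fun_smul hf hz]
  simp
  abel

/-- The Ricci identity. -/
theorem coordCovDeriv_comm {Γ : E → E →L[ℝ] E →L[ℝ] E} {z : E → E} {x : E}
    (hΓ : DifferentiableAt ℝ Γ x) (hz : ContDiffAt ℝ 2 z x) (a b : E) :
    coordCovDeriv Γ (fun y ↦ coordCovDeriv Γ z y b) x a -
      coordCovDeriv Γ (fun y ↦ coordCovDeriv Γ z y a) x b = coordCurvature Γ x a b (z x) := by
  have hz1 : DifferentiableAt ℝ z x := hz.differentiableAt (by norm_num)
  have hd (b : E) : DifferentiableAt ℝ (fun y ↦ fderiv ℝ z y b) x :=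
    ((hz.fderiv_right (m := 1) (by norm_num)).differentiableAt (by norm_num)).clm_apply
      (differentiableAt_const _)
  have hΓ1 (b : E) : DifferentiableAt ℝ (fun y ↦ Γ y b) x :=
    hΓ.clm_apply (differentiableAt_const _)
  -- Of the five terms, the second derivative of z and the two mixed terms together are symmetric in
  -- a and b; the other two antisymmetrise to the curvature.
  have h (a b : E) : coordCovDeriv Γ (fun y ↦ coordCovDeriv Γ z y b) x a =
      fderiv ℝ (fun y ↦ fderiv ℝ z y b) x a + fderiv ℝ Γ x a b (z x) + Γ x b (fderiv ℝ z x a) +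
      Γ x a (fderiv ℝ z x b) + Γ x a (Γ x b (z x)) := by
    simp only [coordCovDeriv]
    rw [fderiv_fun_add (hd b) ((hΓ1 b).clm_apply hz1), fderiv_clm_apply (hΓ1 b) hz1,
      fderiv_clm_apply hΓ (differentiableAt_const _)]
    simp
    abel
  rw [h, h, fderiv_fderiv_comm hz, coordCurvature_apply]
  abel

theorem coordCurvature_swap (Γ : E → E →L[ℝ] E →L[ℝ] E) (x a b c : E) :
    coordCurvature Γ x a b c = -coordCurvature Γ x b a c := by
  simp [coordCurvature]

/-- A quaternionic Kähler structure with Hermitian-Norden metric in coordinates on a set `s`: the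
metric `G`, the almost hypercomplex structure `J`, the Christoffel symbols `Γ` of the Levi-Civita
connection and the 1-forms `η`. -/
structure IsCoordQuaternionicKahler (s : Set E) (G : E → E →L[ℝ] E →L[ℝ] ℝ)
    (J : Fin 3 → E → E →L[ℝ] E) (Γ : E → E →L[ℝ] E →L[ℝ] E) (η : Fin 3 → E → E →L[ℝ] ℝ) :
    Prop where
  isOpen : IsOpen s
  contDiffOn_metric : ContDiffOn ℝ ∞ G s
  contDiffOn_J (α : Fin 3) : ContDiffOn ℝ ∞ (J α) s
  contDiffOn_christoffel : ContDiffOn ℝ ∞ Γ s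
  contDiffOn_form (α : Fin 3) : ContDiffOn ℝ ∞ (η α) s
  symm {x : E} (hx : x ∈ s) (u v : E) : G x u v = G x v u
  nondegenerate {x : E} (hx : x ∈ s) (u : E) (hu : ∀ v, G x u v = 0) : u = 0
  sq (α : Fin 3) {x : E} (hx : x ∈ s) (u : E) : J α x (J α x u) = -u
  comp (α : Fin 3) {x : E} (hx : x ∈ s) (u : E) : J α x u = J (α + 1) x (J (α + 2) x u)
  comp_neg (α : Fin 3) {x : E} (hx : x ∈ s) (u : E) : J α x u = -J (α + 2) x (J (α + 1) x u)
  hermitianNorden (α : Fin 3) {x : E} (hx : x ∈ s) (u v : E) :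
    G x u v = hnSign α * G x (J α x u) (J α x v)
  torsion {x : E} (hx : x ∈ s) (u v : E) : Γ x u v = Γ x v u
  metric {x : E} (hx : x ∈ s) (a u v : E) :
    fderiv ℝ G x a u v = G x (Γ x a u) v + G x u (Γ x a v)
  quaternionic (α : Fin 3) {x : E} (hx : x ∈ s) (a u : E) :
    fderiv ℝ (J α) x a u + Γ x a (J α x u) - J α x (Γ x a u) =
      η (α + 2) x a • J (α + 1) x u - η (α + 1) x a • J (α + 2) x u

theorem ContDiffOn.differentiableAt_of_isOpen {F : Type*} [NormedAddCommGroup F] [NormedSpace ℝ F]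
    {f : E → F} {s : Set E} (hf : ContDiffOn ℝ ∞ f s) (hs : IsOpen s) {x : E} (hx : x ∈ s) :
    DifferentiableAt ℝ f x :=
  (hf.contDiffAt (hs.mem_nhds hx)).differentiableAt (by simp)

namespace IsCoordQuaternionicKahler

variable {s : Set E} {G : E → E →L[ℝ] E →L[ℝ] ℝ} {J : Fin 3 → E → E →L[ℝ] E}
  {Γ : E → E →L[ℝ] E →L[ℝ] E} {η : Fin 3 → E → E →L[ℝ] ℝ}
  (h : IsCoordQuaternionicKahler s G J Γ η) {x : E}

include h

theorem differentiableAt_metric (hx : x ∈ s) : DifferentiableAt ℝ G x :=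
  h.contDiffOn_metric.differentiableAt_of_isOpen h.isOpen hx

theorem differentiableAt_J (α : Fin 3) (hx : x ∈ s) : DifferentiableAt ℝ (J α) x :=
  (h.contDiffOn_J α).differentiableAt_of_isOpen h.isOpen hx

theorem differentiableAt_christoffel (hx : x ∈ s) : DifferentiableAt ℝ Γ x :=
  h.contDiffOn_christoffel.differentiableAt_of_isOpen h.isOpen hx

theorem differentiableAt_form (α : Fin 3) (hx : x ∈ s) : DifferentiableAt ℝ (η α) x :=
  (h.contDiffOn_form α).differentiableAt_of_isOpen h.isOpen hx

theorem fderiv_metric_apply (hx : x ∈ s) {y z : E → E} (hy : DifferentiableAt ℝ y x)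
    (hz : DifferentiableAt ℝ z x) (a : E) :
    fderiv ℝ (fun p ↦ G p (y p) (z p)) x a =
      G x (coordCovDeriv Γ y x a) (z x) + G x (y x) (coordCovDeriv Γ z x a) := by
  have hG := h.differentiableAt_metric hx
  rw [fderiv_clm_apply (hG.clm_apply hy) hz, fderiv_clm_apply hG hy]
  simp [coordCovDeriv, h.metric hx]
  ring

theorem coordCovDeriv_J (α : Fin 3) (hx : x ∈ s) {y : E → E} (hy : DifferentiableAt ℝ y x)
    (a : E) :
    coordCovDeriv Γ (fun p ↦ J α p (y p)) x a = J α x (coordCovDeriv Γ y x a) +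
      (η (α + 2) x a • J (α + 1) x (y x) - η (α + 1) x a • J (α + 2) x (y x)) := by
  rw [← h.quaternionic α hx]
  simp only [coordCovDeriv]
  rw [fderiv_clm_apply (h.differentiableAt_J α hx) hy]
  simp
  abel

theorem metric_J_zero (hx : x ∈ s) (u v : E) : G x (J 0 x u) v = -G x u (J 0 x v) := by
  have := h.hermitianNorden 0 hx u (J 0 x v)
  rw [h.sq _ hx] at this
  simp [hnSign] at this
  linarith

theorem metric_J_one (hx : x ∈ s) (u v : E) : G x (J 1 x u) v = G x u (J 1 x v) := by
  have := h.hermitianNorden 1 hx u (J 1 x v)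
  rw [h.sq _ hx] at this
  simp [hnSign] at this
  linarith

theorem metric_J_two (hx : x ∈ s) (u v : E) : G x (J 2 x u) v = G x u (J 2 x v) := by
  have := h.hermitianNorden 2 hx u (J 2 x v)
  rw [h.sq _ hx] at this
  simp [hnSign] at this
  linarith

/-- Differentiating g(I v, w) = -g(v, I w) shows that D I is skew. As a combination of J and K it is
also symmetric, hence zero, and J, K are linearly independent. -/
theorem form_one_eq_zero_and_form_two_eq_zero [Nontrivial E] (hx : x ∈ s) (a : E) :
    η 1 x a = 0 ∧ η 2 x a = 0 := by
  have key (v : E) : η 2 x a • J 1 x v = η 1 x a • J 2 x v := by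
    rw [← sub_eq_zero]
    refine h.nondegenerate hx _ fun w ↦ ?_
    have hJv (v : E) : DifferentiableAt ℝ (fun p ↦ J 0 p v) x :=
      (h.differentiableAt_J 0 hx).clm_apply (differentiableAt_const v)
    have h1 := h.fderiv_metric_apply hx (hJv v) (differentiableAt_const w) a
    have h2 := h.fderiv_metric_apply hx (differentiableAt_const v) (hJv w) a
    have h3 : (fun p ↦ G p (J 0 p v) w) =ᶠ[𝓝 x] fun p ↦ -G p v (J 0 p w) := by
      filter_upwards [h.isOpen.mem_nhds hx] with p hp using h.metric_J_zero hp v w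
    rw [h3.fderiv_eq, fderiv_fun_neg, neg_apply, h2,
      h.coordCovDeriv_J 0 hx (differentiableAt_const v),
      h.coordCovDeriv_J 0 hx (differentiableAt_const w)] at h1
    simp only [coordCovDeriv_const, zero_add, map_add, add_apply, map_sub,
      sub_apply, map_smul, smul_apply,
      h.metric_J_zero hx, h.metric_J_one hx, h.metric_J_two hx, smul_eq_mul] at h1 ⊢
    linarith
  obtain ⟨v, hv⟩ := exists_ne (0 : E)
  -- Applying K, and then I, turns the relation between J v and K v into two relations between v and
  -- I v; eliminating I v leaves a sum of squares times v.
  have h1 := congrArg (J 2 x) (key v)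
  have h2 := congrArg (J 0 x) h1
  have e1 : J 2 x (J 1 x v) = -J 0 x v := by rw [h.comp_neg 0 hx v]; simp
  simp only [map_smul, e1, h.sq _ hx, map_neg, neg_neg] at h1 h2
  have h3 : (η 1 x a ^ 2 + η 2 x a ^ 2) • v = 0 := by
    have h4 : η 2 x a • (η 2 x a • v) = η 2 x a • (η 1 x a • -J 0 x v) := by rw [h2]
    have h5 : η 1 x a • (η 2 x a • -J 0 x v) = η 1 x a • (η 1 x a • -v) := by rw [h1]
    rw [smul_comm] at h5
    rw [h5] at h4
    simp only [smul_smul, smul_neg] at h4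
    rw [add_smul, pow_two, pow_two, h4]
    abel
  have h6 := (smul_eq_zero.mp h3).resolve_right hv
  constructor <;> nlinarith [sq_nonneg (η 1 x a), sq_nonneg (η 2 x a)]

/-- `I` is parallel. -/
theorem coordCovDeriv_J_zero [Nontrivial E] (hx : x ∈ s) {y : E → E}
    (hy : DifferentiableAt ℝ y x) (a : E) :
    coordCovDeriv Γ (fun p ↦ J 0 p (y p)) x a = J 0 x (coordCovDeriv Γ y x a) := by
  obtain ⟨h1, h2⟩ := h.form_one_eq_zero_and_form_two_eq_zero hx a
  simp [h.coordCovDeriv_J 0 hx hy, h1, h2]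

theorem coordCovDeriv_J_one [Nontrivial E] (hx : x ∈ s) {y : E → E}
    (hy : DifferentiableAt ℝ y x) (a : E) :
    coordCovDeriv Γ (fun p ↦ J 1 p (y p)) x a =
      J 1 x (coordCovDeriv Γ y x a) + η 0 x a • J 2 x (y x) := by
  obtain ⟨h1, h2⟩ := h.form_one_eq_zero_and_form_two_eq_zero hx a
  simp [h.coordCovDeriv_J 1 hx hy, h2, show (1 : Fin 3) + 2 = 0 from rfl,
    show (1 : Fin 3) + 1 = 2 from rfl]

theorem coordCovDeriv_J_two [Nontrivial E] (hx : x ∈ s) {y : E → E}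
    (hy : DifferentiableAt ℝ y x) (a : E) :
    coordCovDeriv Γ (fun p ↦ J 2 p (y p)) x a =
      J 2 x (coordCovDeriv Γ y x a) - η 0 x a • J 1 x (y x) := by
  obtain ⟨h1, h2⟩ := h.form_one_eq_zero_and_form_two_eq_zero hx a
  simp [h.coordCovDeriv_J 2 hx hy, h1, show (2 : Fin 3) + 1 = 0 from rfl,
    show (2 : Fin 3) + 2 = 1 from rfl, sub_eq_add_neg]

theorem differentiableAt_christoffel_apply (hx : x ∈ s) (b c : E) :
    DifferentiableAt ℝ (fun p ↦ Γ p b c) x :=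
  ((h.differentiableAt_christoffel hx).clm_apply (differentiableAt_const b)).clm_apply
    (differentiableAt_const c)

theorem contDiffAt_J_apply (α : Fin 3) (hx : x ∈ s) (c : E) :
    ContDiffAt ℝ ∞ (fun p ↦ J α p c) x :=
  (((h.contDiffOn_J α).contDiffAt (h.isOpen.mem_nhds hx))).clm_apply contDiffAt_const

theorem curvature_eq (hx : x ∈ s) (a b c : E) : coordCurvature Γ x a b c =
    coordCovDeriv Γ (fun p ↦ Γ p b c) x a - coordCovDeriv Γ (fun p ↦ Γ p a c) x b := by
  have := coordCovDeriv_comm (h.differentiableAt_christoffel hx) (z := fun _ ↦ c)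
    contDiffAt_const a b
  simp only [coordCovDeriv_const] at this
  exact this.symm

/-- Second partial derivatives of g(c, d) commute for constant c, d. Expanding them with D g = 0,
the cross terms are symmetric in the two directions and cancel. -/
theorem curvature_metric (hx : x ∈ s) (a b c d : E) :
    G x (coordCurvature Γ x a b c) d = -G x c (coordCurvature Γ x a b d) := by
  have hG : ContDiffAt ℝ 2 (fun p ↦ G p c d) x :=
    (((h.contDiffOn_metric.contDiffAt (h.isOpen.mem_nhds hx)).of_le
      ENat.LEInfty.out).clm_apply contDiffAt_const).clm_apply contDiffAt_const
  have hd (b : E) : (fun p ↦ fderiv ℝ (fun p ↦ G p c d) p b) =ᶠ[𝓝 x]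
      fun p ↦ G p (Γ p b c) d + G p c (Γ p b d) := by
    filter_upwards [h.isOpen.mem_nhds hx] with p hp
    rw [h.fderiv_metric_apply hp (differentiableAt_const c) (differentiableAt_const d)]
    simp only [coordCovDeriv_const]
  have hdiff := h.differentiableAt_metric hx
  have h2 (a b : E) : fderiv ℝ (fun p ↦ fderiv ℝ (fun p ↦ G p c d) p b) x a =
      G x (coordCovDeriv Γ (fun p ↦ Γ p b c) x a) d + G x (Γ x b c) (Γ x a d) +
      (G x (Γ x a c) (Γ x b d) + G x c (coordCovDeriv Γ (fun p ↦ Γ p b d) x a)) := by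
    have hc := h.differentiableAt_christoffel_apply hx b c
    have hd' := h.differentiableAt_christoffel_apply hx b d
    rw [(hd b).fderiv_eq, fderiv_fun_add ((hdiff.clm_apply hc).clm_apply (differentiableAt_const _))
      ((hdiff.clm_apply (differentiableAt_const _)).clm_apply hd'), add_apply,
      h.fderiv_metric_apply hx hc (differentiableAt_const d),
      h.fderiv_metric_apply hx (differentiableAt_const c) hd']
    simp only [coordCovDeriv_const]
  have h3 := fderiv_fderiv_comm hG a b
  rw [h2, h2] at h3
  rw [h.curvature_eq hx, h.curvature_eq hx]
  simp only [map_sub, sub_apply]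
  linarith

theorem curvature_bianchi (hx : x ∈ s) (a b c : E) :
    coordCurvature Γ x a b c + coordCurvature Γ x b c a + coordCurvature Γ x c a b = 0 := by
  have hs (a b c : E) : fderiv ℝ Γ x a b c = fderiv ℝ Γ x a c b := by
    have h1 : (fun p ↦ Γ p b c) =ᶠ[𝓝 x] fun p ↦ Γ p c b := by
      filter_upwards [h.isOpen.mem_nhds hx] with p hp using h.torsion hp b c
    have h2 (b c : E) : fderiv ℝ (fun p ↦ Γ p b c) x a = fderiv ℝ Γ x a b c := by
      have hΓ := h.differentiableAt_christoffel hx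
      rw [fderiv_clm_apply (hΓ.clm_apply (differentiableAt_const b)) (differentiableAt_const c),
        fderiv_clm_apply hΓ (differentiableAt_const b)]
      simp
    rw [← h2, ← h2, h1.fderiv_eq]
  simp only [coordCurvature_apply]
  rw [hs a b c, hs b c a, hs c a b, h.torsion hx b c, h.torsion hx c a, h.torsion hx a b]
  abel

/-- The Ricci identity for the field I c, where I is parallel on a whole neighbourhood and so passes
through both derivatives. -/
theorem curvature_J_zero [Nontrivial E] (hx : x ∈ s) (a b c : E) :
    coordCurvature Γ x a b (J 0 x c) = J 0 x (coordCurvature Γ x a b c) := by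
  have hz := (h.contDiffAt_J_apply 0 hx c).of_le (m := 2) ENat.LEInfty.out
  have h1 (a b : E) : coordCovDeriv Γ (fun y ↦ coordCovDeriv Γ (fun p ↦ J 0 p c) y b) x a =
      J 0 x (coordCovDeriv Γ (fun p ↦ Γ p b c) x a) := by
    rw [← h.coordCovDeriv_J_zero hx (h.differentiableAt_christoffel_apply hx b c)]
    refine coordCovDeriv_congr Γ ?_ a
    filter_upwards [h.isOpen.mem_nhds hx] with p hp
    rw [h.coordCovDeriv_J_zero hp (differentiableAt_const c), coordCovDeriv_const]
  rw [← coordCovDeriv_comm (h.differentiableAt_christoffel hx) hz, h1, h1, ← map_sub,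
    h.curvature_eq hx]

/-- The Ricci identity for the field J c, differentiated by D J = η K and D K = -η J. The terms
linear in η and the η(a) η(b) term are symmetric in a, b, so only dη(a, b) K c is added. -/
theorem curvature_J_one [Nontrivial E] (hx : x ∈ s) (a b c : E) :
    coordCurvature Γ x a b (J 1 x c) = J 1 x (coordCurvature Γ x a b c) +
      (fderiv ℝ (η 0) x a b - fderiv ℝ (η 0) x b a) • J 2 x c := by
  have hz := (h.contDiffAt_J_apply 1 hx c).of_le (m := 2) ENat.LEInfty.out
  have hη (b : E) : DifferentiableAt ℝ (fun p ↦ η 0 p b) x :=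
    (h.differentiableAt_form 0 hx).clm_apply (differentiableAt_const b)
  have hK : DifferentiableAt ℝ (fun p ↦ J 2 p c) x :=
    (h.differentiableAt_J 2 hx).clm_apply (differentiableAt_const c)
  have h1 (a b : E) : coordCovDeriv Γ (fun y ↦ coordCovDeriv Γ (fun p ↦ J 1 p c) y b) x a =
      J 1 x (coordCovDeriv Γ (fun p ↦ Γ p b c) x a) + η 0 x a • J 2 x (Γ x b c) +
        (η 0 x b • (J 2 x (Γ x a c) - η 0 x a • J 1 x c) + fderiv ℝ (η 0) x a b • J 2 x c) := by
    have hc := h.differentiableAt_christoffel_apply hx b c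
    have hηd : fderiv ℝ (fun p ↦ η 0 p b) x a = fderiv ℝ (η 0) x a b := by
      rw [fderiv_clm_apply (h.differentiableAt_form 0 hx) (differentiableAt_const b)]
      simp
    rw [← h.coordCovDeriv_J_one hx hc, ← coordCovDeriv_const Γ x a c,
      ← h.coordCovDeriv_J_two hx (differentiableAt_const c), ← hηd,
      ← coordCovDeriv_smul Γ (hη b) hK, ← coordCovDeriv_add Γ
      ((h.differentiableAt_J 1 hx).clm_apply hc) ((hη b).fun_smul hK)]
    refine coordCovDeriv_congr Γ ?_ a
    filter_upwards [h.isOpen.mem_nhds hx] with p hp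
    rw [h.coordCovDeriv_J_one hp (differentiableAt_const c), coordCovDeriv_const]
  rw [← coordCovDeriv_comm (h.differentiableAt_christoffel hx) hz, h1, h1,
    h.curvature_eq hx, map_sub]
  module

/-- The fundamental form of `I` is closed. -/
theorem fundamentalForm_closed [Nontrivial E] (hx : x ∈ s) (a b c : E) :
    fderiv ℝ (fun p ↦ G p (J 0 p b) c) x a + fderiv ℝ (fun p ↦ G p (J 0 p c) a) x b +
      fderiv ℝ (fun p ↦ G p (J 0 p a) b) x c = 0 := by
  have h1 (a b c : E) : fderiv ℝ (fun p ↦ G p (J 0 p b) c) x a =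
      G x (J 0 x (Γ x a b)) c + G x (J 0 x b) (Γ x a c) := by
    rw [h.fderiv_metric_apply hx ((h.differentiableAt_J 0 hx).clm_apply (differentiableAt_const b))
      (differentiableAt_const c), h.coordCovDeriv_J_zero hx (differentiableAt_const b)]
    simp only [coordCovDeriv_const]
  rw [h1, h1, h1, h.torsion hx b a, h.torsion hx c a, h.torsion hx c b]
  have k1 (u v w : E) : G x (J 0 x (Γ x u v)) w = -G x (Γ x u v) (J 0 x w) :=
    h.metric_J_zero hx _ _
  have k2 (u v w : E) : G x (J 0 x w) (Γ x u v) = G x (Γ x u v) (J 0 x w) := h.symm hx _ _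
  simp only [k1, k2]
  ring

/-- Pointwise Einstein condition. -/
theorem exists_trace_curvature [FiniteDimensional ℝ E] (hdim : 8 ≤ Module.finrank ℝ E)
    (hx : x ∈ s) :
    ∃ μ : ℝ, (∀ a b, fderiv ℝ (η 0) x a b - fderiv ℝ (η 0) x b a = μ * G x (J 0 x a) b) ∧
      ∀ (T : E →ₗ[ℝ] E) (y z : E), (∀ a, T a = coordCurvature Γ x a y z) →
        LinearMap.trace ℝ E T = -(Module.finrank ℝ E / 4 : ℝ) * μ * G x y z := by
  have : Nontrivial E := Module.nontrivial_of_finrank_pos (R := ℝ) (by omega)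
  have e02 (u : E) : J 0 x u = J 1 x (J 2 x u) := h.comp 0 hx u
  have e02' (u : E) : J 0 x u = -J 2 x (J 1 x u) := h.comp_neg 0 hx u
  have e10 (u : E) : J 1 x u = J 2 x (J 0 x u) := h.comp 1 hx u
  have e10' (u : E) : J 1 x u = -J 0 x (J 2 x u) := h.comp_neg 1 hx u
  have e21 (u : E) : J 2 x u = J 0 x (J 1 x u) := h.comp 2 hx u
  have e21' (u : E) : J 2 x u = -J 1 x (J 0 x u) := h.comp_neg 2 hx u
  obtain ⟨μ, h1, h2⟩ := exists_ricci_eq_smul_of_commutator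
    (LinearMap.mk₂ ℝ (fun a b ↦ G x a b) (by simp) (by simp) (by simp) (by simp))
    (h.symm hx) (h.nondegenerate hx) (J 0 x : E →ₗ[ℝ] E) (J 1 x : E →ₗ[ℝ] E) (J 2 x : E →ₗ[ℝ] E)
    (h.sq 0 hx) (h.sq 1 hx) (h.sq 2 hx) (fun u ↦ (e02 u).symm)
    (fun u ↦ (neg_eq_iff_eq_neg.mpr (e02' u)).symm)
    (fun u ↦ (e21 u).symm) (fun u ↦ (neg_eq_iff_eq_neg.mpr (e21' u)).symm)
    (fun u ↦ (neg_eq_iff_eq_neg.mpr (e10' u)).symm)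
    (h.metric_J_zero hx) (h.metric_J_one hx)
    (LinearMap.mk₂ ℝ (fun a b ↦ (coordCurvature Γ x a b : E →ₗ[ℝ] E)) (fun _ _ _ ↦ by ext; simp)
      (fun _ _ _ ↦ by ext; simp) (fun _ _ _ ↦ by ext; simp) (fun _ _ _ ↦ by ext; simp))
    (LinearMap.mk₂ ℝ (fun a b ↦ fderiv ℝ (η 0) x a b - fderiv ℝ (η 0) x b a)
      (fun _ _ _ ↦ by simp; ring) (fun _ _ _ ↦ by simp; ring) (fun _ _ _ ↦ by simp; ring)
      (fun _ _ _ ↦ by simp; ring))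
    (coordCurvature_swap Γ x) (h.curvature_metric hx) (h.curvature_bianchi hx) (h.curvature_J_zero hx)
    (h.curvature_J_one hx) hdim
  refine ⟨μ, h1, fun T y z hT ↦ ?_⟩
  refine Eq.trans ?_ (h2 y z)
  congr 1
  ext a
  exact hT a

end IsCoordQuaternionicKahler

end Coordinates

/-! ### Wedge product with a nondegenerate 2-form -/

section Wedge

/-- In dimension at least three the wedge product with a nondegenerate 2-form is injective on linear
forms. -/
theorem eq_zero_of_wedge_nondegenerate {V : Type*} [AddCommGroup V] [Module ℝ V]
    [FiniteDimensional ℝ V] (hdim : 3 ≤ Module.finrank ℝ V) (F : V →ₗ[ℝ] V →ₗ[ℝ] ℝ)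
    (hF : ∀ u v, F u v = -F v u) (hnd : ∀ u, (∀ v, F u v = 0) → u = 0) (a : V →ₗ[ℝ] ℝ)
    (h : ∀ u v w, a u * F v w + a v * F w u + a w * F u v = 0) (u : V) : a u = 0 := by
  by_contra hu
  obtain ⟨A, hA⟩ : ∃ A, F A = a := by
    have hinj : Function.Injective F := by
      rw [injective_iff_map_eq_zero]
      exact fun u hu ↦ hnd u fun v ↦ by simp [hu]
    exact (LinearMap.injective_iff_surjective_of_finrank_eq_finrank
        (f := F) (Subspace.dual_finrank_eq).symm).mp hinj a
  obtain ⟨v, hv⟩ : ∃ v, v ∉ Submodule.span ℝ {u, A} := by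
    by_contra! hall
    classical
    have h1 := finrank_span_finset_le_card (R := ℝ) ({u, A} : Finset V)
    rw [Finset.coe_pair, Set.finrank, (Submodule.eq_top_iff').mpr hall, finrank_top] at h1
    have h2 := Finset.card_le_two (a := u) (b := A)
    omega
  apply hv
  -- The hypothesis says that this vector is F-orthogonal to every w, since a = F(A, ·). As a(u) ≠
  -- 0, it puts v into the span of u and A.
  have hz : a u • v - a v • u + F u v • A = 0 := by
    refine hnd _ fun w ↦ ?_
    have := h u v w
    rw [hF w u] at this
    simp [hA]
    linarith
  have hv' : v = (a u)⁻¹ • (a v • u - F u v • A) := by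
    rw [eq_inv_smul_iff₀ hu]
    rw [← sub_eq_zero, ← hz]
    abel
  rw [hv']
  refine Submodule.smul_mem _ _ (Submodule.sub_mem _ (Submodule.smul_mem _ _ ?_)
    (Submodule.smul_mem _ _ ?_)) <;> exact Submodule.subset_span (by simp)

end Wedge

/-! ### Schur's lemma in a chart -/

namespace IsCoordQuaternionicKahler

open Filter Topology

variable {E : Type*} [NormedAddCommGroup E] [NormedSpace ℝ E]
  {s : Set E} {G : E → E →L[ℝ] E →L[ℝ] ℝ} {J : Fin 3 → E → E →L[ℝ] E}
  {Γ : E → E →L[ℝ] E →L[ℝ] E} {η : Fin 3 → E → E →L[ℝ] ℝ}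
  (h : IsCoordQuaternionicKahler s G J Γ η) {x : E}

include h

theorem differentiableAt_fundamentalForm (hx : x ∈ s) (b c : E) :
    DifferentiableAt ℝ (fun p ↦ G p (J 0 p b) c) x :=
  ((h.differentiableAt_metric hx).clm_apply ((h.differentiableAt_J 0 hx).clm_apply
    (differentiableAt_const b))).clm_apply (differentiableAt_const c)

theorem exists_fundamentalForm_ne_zero [Nontrivial E] (hx : x ∈ s) :
    ∃ v w, G x (J 0 x v) w ≠ 0 := by
  obtain ⟨v, hv⟩ := exists_ne (0 : E)
  refine ⟨v, ?_⟩
  by_contra! h0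
  have := h.sq 0 hx v
  rw [h.nondegenerate hx _ h0, map_zero] at this
  exact hv (neg_eq_zero.mp this.symm)

/-- The exterior derivative of dη = μ F is 0 = dμ ∧ F + μ dF, and dF = 0, so the wedge lemma applies
to dμ. -/
theorem hasFDerivAt_zero_of_exteriorDerivative_eq [FiniteDimensional ℝ E]
    (hdim : 8 ≤ Module.finrank ℝ E) {μ : E → ℝ}
    (hμ : ∀ x ∈ s, ∀ a b,
      fderiv ℝ (η 0) x a b - fderiv ℝ (η 0) x b a = μ x * G x (J 0 x a) b) (hx : x ∈ s) :
    DifferentiableAt ℝ μ x ∧ fderiv ℝ μ x = 0 := by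
  have : Nontrivial E := Module.nontrivial_of_finrank_pos (R := ℝ) (by omega)
  have hη : ContDiffAt ℝ 2 (η 0) x := ((h.contDiffOn_form 0).contDiffAt (h.isOpen.mem_nhds hx)).of_le
    ENat.LEInfty.out
  have hηb (b : E) : ContDiffAt ℝ 2 (fun p ↦ η 0 p b) x := hη.clm_apply contDiffAt_const
  have hD : DifferentiableAt ℝ (fderiv ℝ (η 0)) x :=
    (hη.fderiv_right (m := 1) (by norm_num)).differentiableAt (by norm_num)
  have hDab (a b : E) : DifferentiableAt ℝ (fun p ↦ fderiv ℝ (η 0) p a b) x :=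
    (hD.clm_apply (differentiableAt_const a)).clm_apply (differentiableAt_const b)
  have hΩ (a b : E) : DifferentiableAt ℝ
      (fun p ↦ fderiv ℝ (η 0) p a b - fderiv ℝ (η 0) p b a) x := (hDab a b).fun_sub (hDab b a)
  -- No regularity of μ is assumed: near x it is the quotient dη(v, w) / F(v, w) for fixed v, w with
  -- nonzero denominator.
  have hμd : DifferentiableAt ℝ μ x := by
    obtain ⟨v, w, hvw⟩ := h.exists_fundamentalForm_ne_zero hx
    have hF := h.differentiableAt_fundamentalForm hx v w
    refine ((hΩ v w).fun_mul (hF.fun_inv hvw)).congr_of_eventuallyEq ?_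
    filter_upwards [h.isOpen.mem_nhds hx, hF.continuousAt.eventually_ne hvw] with p hp hpF
    rw [hμ p hp, mul_assoc, mul_inv_cancel₀ hpF, mul_one]
  refine ⟨hμd, ?_⟩
  -- Symmetry of the second derivatives of η; its cyclic sum is d(dη) = 0.
  have hsnd (a b c : E) : fderiv ℝ (fun p ↦ fderiv ℝ (η 0) p b c) x a =
      fderiv ℝ (fun p ↦ fderiv ℝ (η 0) p a c) x b := by
    have e (b : E) : (fun p ↦ fderiv ℝ (η 0) p b c) =ᶠ[𝓝 x]
        fun p ↦ fderiv ℝ (fun q ↦ η 0 q c) p b := by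
      filter_upwards [h.isOpen.mem_nhds hx] with p hp
      rw [fderiv_clm_apply (h.differentiableAt_form 0 hp) (differentiableAt_const c)]
      simp
    rw [(e b).fderiv_eq, (e a).fderiv_eq, fderiv_fderiv_comm (hηb c)]
  have hL (a b c : E) : fderiv ℝ (fun p ↦ fderiv ℝ (η 0) p b c) x a -
      fderiv ℝ (fun p ↦ fderiv ℝ (η 0) p c b) x a = μ x *
      fderiv ℝ (fun p ↦ G p (J 0 p b) c) x a + fderiv ℝ μ x a * G x (J 0 x b) c := by
    have e : (fun p ↦ fderiv ℝ (η 0) p b c - fderiv ℝ (η 0) p c b) =ᶠ[𝓝 x]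
        fun p ↦ μ p * G p (J 0 p b) c := by
      filter_upwards [h.isOpen.mem_nhds hx] with p hp using hμ p hp b c
    have e2 := e.fderiv_eq (𝕜 := ℝ)
    rw [fderiv_fun_sub (hDab b c) (hDab c b),
      fderiv_fun_mul hμd (h.differentiableAt_fundamentalForm hx b c)] at e2
    have e3 := congrArg (fun L ↦ L a) e2
    simp only [sub_apply, add_apply, smul_apply, smul_eq_mul] at e3
    rw [e3]
    ring
  ext u
  refine eq_zero_of_wedge_nondegenerate (by omega)
    (LinearMap.mk₂ ℝ (fun a b ↦ G x (J 0 x a) b) (by simp) (by simp) (by simp) (by simp))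
    (fun u v ↦ ?_) (fun u hu ↦ ?_) (fderiv ℝ μ x : E →ₗ[ℝ] ℝ) (fun a b c ↦ ?_) u
  · simp only [LinearMap.mk₂_apply]
    rw [h.metric_J_zero hx, h.symm hx]
  · have := h.nondegenerate hx _ hu
    have h2 := h.sq 0 hx u
    rw [this, map_zero] at h2
    exact neg_eq_zero.mp h2.symm
  · simp only [LinearMap.mk₂_apply, ContinuousLinearMap.coe_coe]
    have h1 := h.fundamentalForm_closed hx a b c
    linear_combination (-μ x) * h1 - hL a b c - hL b c a - hL c a b + hsnd a b c + hsnd b c a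
      + hsnd c a b

/-- Schur's lemma. -/
theorem eventually_eq_of_exteriorDerivative_eq [FiniteDimensional ℝ E]
    (hdim : 8 ≤ Module.finrank ℝ E) {μ : E → ℝ}
    (hμ : ∀ x ∈ s, ∀ a b,
      fderiv ℝ (η 0) x a b - fderiv ℝ (η 0) x b a = μ x * G x (J 0 x a) b) (hx : x ∈ s) :
    ∀ᶠ y in 𝓝 x, μ y = μ x := by
  obtain ⟨r, hr, hball⟩ := Metric.isOpen_iff.mp h.isOpen x hx
  filter_upwards [Metric.ball_mem_nhds x hr] with y hy
  have hd := fun p hp ↦ h.hasFDerivAt_zero_of_exteriorDerivative_eq hdim hμ (hball hp) (x := p)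
  refine (convex_ball x r).is_const_of_fderivWithin_eq_zero (𝕜 := ℝ)
    (fun p hp ↦ (hd p hp).1.differentiableWithinAt) (fun p hp ↦ ?_) hy (Metric.mem_ball_self hr)
  rw [fderivWithin_of_isOpen Metric.isOpen_ball hp, (hd p hp).2]

end IsCoordQuaternionicKahler

/-! ### Coordinate vector fields on the manifold -/

section Frame

open Filter Topology

variable {E : Type*} [NormedAddCommGroup E] [NormedSpace ℝ E]
  {M : Type*} [TopologicalSpace M] [ChartedSpace E M] [IsManifold 𝓘(ℝ, E) ∞ M]

/-- The vector field with constant coordinates `a` in the preferred chart at `p₀`. -/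
noncomputable def coordFrame (p₀ : M) (a : E) (q : M) : TangentSpace 𝓘(ℝ, E) q :=
  (trivializationAt E (TangentSpace 𝓘(ℝ, E) : M → Type _) p₀).symmL ℝ q a

/-- The coordinates, in the preferred chart at `p₀`, of a vector field. -/
noncomputable def coordRepr (p₀ : M) (Z : Π q : M, TangentSpace 𝓘(ℝ, E) q) (q : M) : E :=
  (trivializationAt E (TangentSpace 𝓘(ℝ, E) : M → Type _) p₀).continuousLinearMapAt ℝ q (Z q)

theorem mem_baseSet_of_mem_source {p₀ q : M} (hq : q ∈ (chartAt E p₀).source) :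
    q ∈ (trivializationAt E (TangentSpace 𝓘(ℝ, E) : M → Type _) p₀).baseSet := hq

theorem coordRepr_coordFrame {p₀ q : M} (hq : q ∈ (chartAt E p₀).source) (a : E) :
    coordRepr p₀ (coordFrame p₀ a) q = a :=
  Trivialization.continuousLinearMapAt_symmL _ (mem_baseSet_of_mem_source hq) a

theorem coordFrame_coordRepr {p₀ q : M} (hq : q ∈ (chartAt E p₀).source)
    (Z : Π q : M, TangentSpace 𝓘(ℝ, E) q) : coordFrame p₀ (coordRepr p₀ Z q) q = Z q :=
  Trivialization.symmL_continuousLinearMapAt _ (mem_baseSet_of_mem_source hq) (Z q)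

theorem coordRepr_add (p₀ : M) (Z Z' : Π q : M, TangentSpace 𝓘(ℝ, E) q) :
    coordRepr p₀ (Z + Z') = coordRepr p₀ Z + coordRepr p₀ Z' := by
  funext q
  simp [coordRepr]

theorem coordRepr_smul (p₀ : M) (f : M → ℝ) (Z : Π q : M, TangentSpace 𝓘(ℝ, E) q) :
    coordRepr p₀ (f • Z) = f • coordRepr p₀ Z := by
  funext q
  simp [coordRepr]

theorem coordFrame_add (p₀ : M) (a b : E) :
    coordFrame p₀ (a + b) = coordFrame p₀ a + coordFrame p₀ b := by
  funext q
  simp [coordFrame]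

theorem coordFrame_smul (p₀ : M) (r : ℝ) (a : E) :
    coordFrame p₀ (r • a) = r • coordFrame p₀ a := by
  funext q
  simp [coordFrame]

/-- The extensions used to define curvature and exterior derivative have constant coordinates near
p, so they can be handled as coordinate fields. -/
theorem extend_eq_coordFrame {p q : M} (hq : q ∈ (chartAt E p).source)
    (u : TangentSpace 𝓘(ℝ, E) p) :
    FiberBundle.extend E u q = coordFrame p
      ((trivializationAt E (TangentSpace 𝓘(ℝ, E) : M → Type _) p).continuousLinearMapAt ℝ p u)
      q := by
  rw [coordFrame, Trivialization.continuousLinearMapAt_apply_of_mem _ (R := ℝ)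
    (FiberBundle.mem_baseSet_trivializationAt' p) u,
    Trivialization.symmL_apply _ (mem_baseSet_of_mem_source hq)]
  rfl

theorem mdifferentiableAt_iff_coordRepr {p₀ q : M} (hq : q ∈ (chartAt E p₀).source)
    {Z : Π q : M, TangentSpace 𝓘(ℝ, E) q} :
    MDiffAt (T% Z) q ↔ MDiffAt (coordRepr p₀ Z) q := by
  rw [(trivializationAt E (TangentSpace 𝓘(ℝ, E) : M → Type _) p₀).mdifferentiableAt_section_iff
    𝓘(ℝ, E) Z (mem_baseSet_of_mem_source hq)]
  have : (fun x ↦ ((trivializationAt E (TangentSpace 𝓘(ℝ, E) : M → Type _) p₀) ⟨x, Z x⟩).2)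
      =ᶠ[𝓝 q] coordRepr p₀ Z := by
    filter_upwards [(chartAt E p₀).open_source.mem_nhds hq] with x hx
    exact ((Trivialization.continuousLinearMapAt_apply_of_mem _ (R := ℝ)
      (mem_baseSet_of_mem_source hx) (Z x))).symm
  exact this.mdifferentiableAt_iff

theorem contMDiffAt_iff_coordRepr {p₀ q : M} (hq : q ∈ (chartAt E p₀).source)
    {Z : Π q : M, TangentSpace 𝓘(ℝ, E) q} :
    CMDiffAt ∞ (T% Z) q ↔ CMDiffAt ∞ (coordRepr p₀ Z) q := by
  rw [(trivializationAt E (TangentSpace 𝓘(ℝ, E) : M → Type _) p₀).contMDiffAt_section_iff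
    (mem_baseSet_of_mem_source hq)]
  have : (fun x ↦ ((trivializationAt E (TangentSpace 𝓘(ℝ, E) : M → Type _) p₀) ⟨x, Z x⟩).2)
      =ᶠ[𝓝 q] coordRepr p₀ Z := by
    filter_upwards [(chartAt E p₀).open_source.mem_nhds hq] with x hx
    exact ((Trivialization.continuousLinearMapAt_apply_of_mem _ (R := ℝ)
      (mem_baseSet_of_mem_source hx) (Z x))).symm
  exact this.contMDiffAt_iff

theorem contMDiffAt_coordFrame {p₀ q : M} (hq : q ∈ (chartAt E p₀).source) (a : E) :
    CMDiffAt ∞ (T% (coordFrame p₀ a)) q := by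
  rw [contMDiffAt_iff_coordRepr hq]
  refine (contMDiffAt_const (c := a)).congr_of_eventuallyEq ?_
  filter_upwards [(chartAt E p₀).open_source.mem_nhds hq] with x hx
  exact coordRepr_coordFrame hx a

theorem mdifferentiableAt_coordFrame {p₀ q : M} (hq : q ∈ (chartAt E p₀).source) (a : E) :
    MDiffAt (T% (coordFrame p₀ a)) q :=
  (contMDiffAt_coordFrame hq a).mdifferentiableAt (by simp)

theorem coordFrame_eq_mfderiv {p₀ q : M} (hq : q ∈ (chartAt E p₀).source) (a : E) :
    coordFrame p₀ a q = mfderiv[Set.range 𝓘(ℝ, E)] (extChartAt 𝓘(ℝ, E) p₀).symm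
      (extChartAt 𝓘(ℝ, E) p₀ q) a := by
  have h := TangentBundle.symmL_trivializationAt (I := 𝓘(ℝ, E)) hq
  exact congrArg (fun L ↦ L a) h

omit [IsManifold 𝓘(ℝ, E) ∞ M] in
theorem mem_source_of_mem_target {p₀ : M} {x : E} (hx : x ∈ (extChartAt 𝓘(ℝ, E) p₀).target) :
    (extChartAt 𝓘(ℝ, E) p₀).symm x ∈ (chartAt E p₀).source := by
  simpa using (extChartAt 𝓘(ℝ, E) p₀).map_target hx

theorem contMDiffAt_extChartAt_symm_of_mem {p₀ : M} {x : E}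
    (hx : x ∈ (extChartAt 𝓘(ℝ, E) p₀).target) :
    CMDiffAt ∞ (extChartAt 𝓘(ℝ, E) p₀).symm x :=
  (contMDiffOn_extChartAt_symm p₀).contMDiffAt ((isOpen_extChartAt_target p₀).mem_nhds hx)

theorem contDiffAt_comp_extChartAt_symm {F : Type*} [NormedAddCommGroup F] [NormedSpace ℝ F]
    {p₀ : M} {x : E} (hx : x ∈ (extChartAt 𝓘(ℝ, E) p₀).target) {f : M → F}
    (hf : CMDiffAt ∞ f ((extChartAt 𝓘(ℝ, E) p₀).symm x)) :
    ContDiffAt ℝ ∞ (f ∘ (extChartAt 𝓘(ℝ, E) p₀).symm) x :=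
  (hf.comp x (contMDiffAt_extChartAt_symm_of_mem hx)).contDiffAt

/-- Differentiation along a coordinate field is partial differentiation. -/
theorem mvfderiv_coordFrame {F : Type*} [NormedAddCommGroup F] [NormedSpace ℝ F]
    {p₀ : M} {x : E} (hx : x ∈ (extChartAt 𝓘(ℝ, E) p₀).target) {f : M → F}
    (hf : MDiffAt f ((extChartAt 𝓘(ℝ, E) p₀).symm x)) (a : E) :
    mvfderiv 𝓘(ℝ, E) f ((extChartAt 𝓘(ℝ, E) p₀).symm x)
      (coordFrame p₀ a ((extChartAt 𝓘(ℝ, E) p₀).symm x)) =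
      fderiv ℝ (f ∘ (extChartAt 𝓘(ℝ, E) p₀).symm) x a := by
  have hd := (contMDiffAt_extChartAt_symm_of_mem hx).mdifferentiableAt (by simp)
  have hq := mem_source_of_mem_target hx
  rw [coordFrame_eq_mfderiv hq, (extChartAt 𝓘(ℝ, E) p₀).right_inv hx, ← mfderiv_eq_fderiv,
    mfderiv_comp x hf hd, ModelWithCorners.range_eq_univ, mfderivWithin_univ]
  rfl

/-- Coordinate fields are pullbacks of constant fields under the chart, and pullback commutes with
the bracket. -/
theorem mlieBracket_coordFrame [CompleteSpace E] {p₀ q : M} (hq : q ∈ (chartAt E p₀).source) (a b : E) :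
    VectorField.mlieBracket 𝓘(ℝ, E) (coordFrame p₀ a) (coordFrame p₀ b) q = 0 := by
  let C (a : E) : Π x : E, TangentSpace 𝓘(ℝ, E) x := fun _ ↦ a
  have hc (a : E) : coordFrame p₀ a =ᶠ[𝓝 q] VectorField.mpullback 𝓘(ℝ, E) 𝓘(ℝ, E)
      (extChartAt 𝓘(ℝ, E) p₀) (C a) := by
    filter_upwards [(chartAt E p₀).open_source.mem_nhds hq] with y hy
    have hy' : y ∈ (extChartAt 𝓘(ℝ, E) p₀).source := by simpa using hy
    have h1 := mfderiv_extChartAt_comp_mfderivWithin_extChartAt_symm' hy'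
    refine Eq.symm (((isInvertible_mfderiv_extChartAt hy').inverse_apply_eq).mpr ?_)
    rw [coordFrame_eq_mfderiv hy]
    exact (congrArg (fun L ↦ L a) h1).symm
  have hC (a : E) : MDiffAt (T% (C a)) (extChartAt 𝓘(ℝ, E) p₀ q) := by
    exact (contMDiffAt_vectorSpace_iff_contDiffAt.mpr contDiffAt_const).mdifferentiableAt
      one_ne_zero
  have : IsManifold 𝓘(ℝ, E) (minSmoothness ℝ 2) M := by
    rw [minSmoothness_of_isRCLikeNormedField]
    infer_instance
  have : IsManifold 𝓘(ℝ, E) (minSmoothness ℝ 2) E := by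
    rw [minSmoothness_of_isRCLikeNormedField]
    infer_instance
  rw [(hc a).mlieBracket_vectorField_eq (hc b), ← VectorField.mpullback_mlieBracket (n := 2)
    (hC a) (hC b) ((contMDiffAt_extChartAt' hq).of_le ENat.LEInfty.out) (by simp)]
  have h0 : VectorField.mlieBracket 𝓘(ℝ, E) (C a) (C b) (extChartAt 𝓘(ℝ, E) p₀ q) = 0 := by
    rw [← VectorField.mlieBracketWithin_univ, VectorField.mlieBracketWithin_eq_lieBracketWithin]
    simp [VectorField.lieBracketWithin, C]
    rfl
  rw [VectorField.mpullback_apply, h0, map_zero]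

theorem mdifferentiableAt_congr_section {Z Z' : Π q : M, TangentSpace 𝓘(ℝ, E) q} {p : M}
    (h : ∀ᶠ q in 𝓝 p, Z q = Z' q) (hZ : MDiffAt (T% Z) p) : MDiffAt (T% Z') p := by
  refine hZ.congr_of_eventuallyEq ?_
  filter_upwards [h] with q hq
  rw [hq]

end Frame

/-! ### Christoffel symbols of a covariant derivative -/

section Bridge

open Filter Topology

variable {E : Type*} [NormedAddCommGroup E] [NormedSpace ℝ E] [FiniteDimensional ℝ E]
  {M : Type*} [TopologicalSpace M] [ChartedSpace E M] [IsManifold 𝓘(ℝ, E) ∞ M]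
  (D : CovariantDerivative 𝓘(ℝ, E) E (TangentSpace 𝓘(ℝ, E) : M → Type _))

open scoped Classical in
/-- The Christoffel symbols of `D` in the preferred chart at `p₀`. -/
noncomputable def christoffel (p₀ : M) (x : E) : E →L[ℝ] E →L[ℝ] E :=
  -- Linearity in b rests on differentiability of the coordinate fields, which is available over the
  -- chart domain; the value elsewhere is irrelevant.
  if h : (extChartAt 𝓘(ℝ, E) p₀).symm x ∈ (chartAt E p₀).source then
    LinearMap.toContinuousBilinearMap (LinearMap.mk₂ ℝ
      (fun a b ↦ (trivializationAt E (TangentSpace 𝓘(ℝ, E) : M → Type _) p₀).continuousLinearMapAt ℝ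
        ((extChartAt 𝓘(ℝ, E) p₀).symm x) (D (coordFrame p₀ b) ((extChartAt 𝓘(ℝ, E) p₀).symm x)
          (coordFrame p₀ a ((extChartAt 𝓘(ℝ, E) p₀).symm x))))
      (fun a a' b ↦ by simp only [coordFrame, map_add])
      (fun r a b ↦ by simp only [coordFrame, map_smul])
      (fun a b b' ↦ by
        rw [coordFrame_add, D.isCovariantDerivativeOn.add (mdifferentiableAt_coordFrame h b)
          (mdifferentiableAt_coordFrame h b')]
        simp only [add_apply, map_add])
      (fun r a b ↦ by
        rw [coordFrame_smul, D.isCovariantDerivativeOn.smul_const r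
          (mdifferentiableAt_coordFrame h b)]
        simp only [smul_apply, map_smul]))
  else 0

theorem christoffel_apply {p₀ : M} {x : E} (hx : x ∈ (extChartAt 𝓘(ℝ, E) p₀).target) (a b : E) :
    christoffel D p₀ x a b =
      coordRepr p₀ (fun q ↦ D (coordFrame p₀ b) q (coordFrame p₀ a q))
        ((extChartAt 𝓘(ℝ, E) p₀).symm x) := by
  rw [christoffel, dif_pos (mem_source_of_mem_target hx)]
  rfl

/-- A covariant derivative in coordinates. -/
theorem coordRepr_covariantDerivative {p₀ : M} {x : E}
    (hx : x ∈ (extChartAt 𝓘(ℝ, E) p₀).target) {Z : Π q : M, TangentSpace 𝓘(ℝ, E) q}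
    (hZ : MDiffAt (T% Z) ((extChartAt 𝓘(ℝ, E) p₀).symm x)) (a : E) :
    coordRepr p₀ (fun q ↦ D Z q (coordFrame p₀ a q)) ((extChartAt 𝓘(ℝ, E) p₀).symm x) =
      coordCovDeriv (christoffel D p₀) (coordRepr p₀ Z ∘ (extChartAt 𝓘(ℝ, E) p₀).symm) x a := by
  set q := (extChartAt 𝓘(ℝ, E) p₀).symm x with hq
  have hqs : q ∈ (chartAt E p₀).source := mem_source_of_mem_target hx
  -- The difference between D and the coordinate derivative is tensorial, so Z may be replaced by
  -- the coordinate field with the same value at q.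
  let Φ (Z : Π q : M, TangentSpace 𝓘(ℝ, E) q) : E :=
    coordRepr p₀ (fun q ↦ D Z q (coordFrame p₀ a q)) q -
      mvfderiv 𝓘(ℝ, E) (coordRepr p₀ Z) q (coordFrame p₀ a q)
  have hΦ : TensorialAt 𝓘(ℝ, E) E Φ q := by
    constructor
    · intro f σ hf hσ
      have hσ' := (mdifferentiableAt_iff_coordRepr hqs).mp hσ
      simp only [Φ]
      rw [coordRepr_smul, mvfderiv_smul hf hσ']
      simp only [coordRepr]
      rw [D.isCovariantDerivativeOn.leibniz hσ hf]
      simp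
      module
    · intro σ σ' hσ hσ'
      have h1 := (mdifferentiableAt_iff_coordRepr hqs).mp hσ
      have h2 := (mdifferentiableAt_iff_coordRepr hqs).mp hσ'
      simp only [Φ]
      rw [coordRepr_add, mvfderiv_add h1 h2]
      simp only [coordRepr]
      rw [D.isCovariantDerivativeOn.add hσ hσ']
      simp
      abel
  have hZ' := (mdifferentiableAt_iff_coordRepr hqs).mp hZ
  have key := hΦ.pointwise hZ (mdifferentiableAt_coordFrame hqs (coordRepr p₀ Z q))
    (coordFrame_coordRepr hqs Z).symm
  have hconst : mvfderiv 𝓘(ℝ, E) (coordRepr p₀ (coordFrame p₀ (coordRepr p₀ Z q))) q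
      (coordFrame p₀ a q) = 0 := by
    rw [mvfderiv_coordFrame hx ((mdifferentiableAt_iff_coordRepr hqs).mp
      (mdifferentiableAt_coordFrame hqs _))]
    have : coordRepr p₀ (coordFrame p₀ (coordRepr p₀ Z q)) ∘ (extChartAt 𝓘(ℝ, E) p₀).symm =ᶠ[𝓝 x]
        fun _ ↦ coordRepr p₀ Z q := by
      filter_upwards [(isOpen_extChartAt_target p₀).mem_nhds hx] with y hy
      exact coordRepr_coordFrame (mem_source_of_mem_target hy) _
    rw [this.fderiv_eq]
    simp
  simp only [Φ] at key
  rw [hconst, sub_zero, mvfderiv_coordFrame hx hZ', ← christoffel_apply D hx] at key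
  rw [coordCovDeriv, eq_comm, add_comm]
  exact (sub_eq_iff_eq_add.mp key).symm

variable [T2Space M]

/-- The covariant derivative of a coordinate field is smooth. -/
theorem contMDiffAt_covariantDerivative_coordFrame
    (hD : ContMDiffCovariantDerivativeOn E ∞ D.toFun Set.univ) {p₀ q : M}
    (hq : q ∈ (chartAt E p₀).source) (b : E) :
    ContMDiffAt 𝓘(ℝ, E) (𝓘(ℝ, E).prod 𝓘(ℝ, E →L[ℝ] E)) ∞
      (fun m ↦ TotalSpace.mk' (E →L[ℝ] E)
        (E := fun p : M ↦ TangentSpace 𝓘(ℝ, E) p →L[ℝ] TangentSpace 𝓘(ℝ, E) p) m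
        (D (coordFrame p₀ b) m)) q := by
  -- Smoothness of D is stated for global smooth sections, so the coordinate field is cut off by a
  -- bump function equal to 1 near q; locality of D removes the cutoff.
  obtain ⟨ψ, hψs, -⟩ := (SmoothBumpFunction.nhds_basis_support (I := 𝓘(ℝ, E))
    ((chartAt E p₀).open_source.mem_nhds hq)).mem_iff.mp Filter.univ_mem
  have hσ : CMDiff ∞ (T% ((ψ : M → ℝ) • coordFrame p₀ b)) := by
    refine ContMDiffOn.smul_section_of_tsupport (u := (chartAt E p₀).source)
      ψ.contMDiff.contMDiffOn (chartAt E p₀).open_source hψs fun y hy ↦ ?_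
    exact (contMDiffAt_coordFrame hy b).contMDiffWithinAt
  have h1 := hD.contMDiff (σ := (ψ : M → ℝ) • coordFrame p₀ b) (by simpa using hσ.contMDiffOn)
  refine (h1.contMDiffAt Filter.univ_mem).congr_of_eventuallyEq ?_
  have h2 : ∀ᶠ m in 𝓝 q, ((ψ : M → ℝ) • coordFrame p₀ b) m = coordFrame p₀ b m := by
    filter_upwards [ψ.eventuallyEq_one] with m hm
    simp [hm]
  filter_upwards [h2.eventually_nhds, (chartAt E p₀).open_source.mem_nhds hq] with m hm hms
  have h3 : D.toFun ((ψ : M → ℝ) • coordFrame p₀ b) m = D.toFun (coordFrame p₀ b) m :=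
    D.isCovariantDerivativeOn.congr_of_eventuallyEq
      (hσ.mdifferentiable (by simp) m) (mdifferentiableAt_coordFrame hms b) Filter.univ_mem hm
  exact congrArg (TotalSpace.mk' (E →L[ℝ] E)
        (E := fun p : M ↦ TangentSpace 𝓘(ℝ, E) p →L[ℝ] TangentSpace 𝓘(ℝ, E) p) m) h3.symm

theorem contDiffOn_christoffel
    (hD : ContMDiffCovariantDerivativeOn E ∞ D.toFun Set.univ) (p₀ : M) :
    ContDiffOn ℝ ∞ (christoffel D p₀) (extChartAt 𝓘(ℝ, E) p₀).target := by
  refine contDiffOn_clm_apply.mpr fun a ↦ contDiffOn_clm_apply.mpr fun b ↦ ?_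
  have h (x : E) (hx : x ∈ (extChartAt 𝓘(ℝ, E) p₀).target) := contDiffAt_comp_extChartAt_symm hx
    ((contMDiffAt_iff_coordRepr (mem_source_of_mem_target hx)).mp
    ((contMDiffAt_covariantDerivative_coordFrame D hD (mem_source_of_mem_target hx) b
      ).clm_bundle_apply (contMDiffAt_coordFrame (mem_source_of_mem_target hx) a)))
  refine ContDiffOn.congr (fun x hx ↦ (h x hx).contDiffWithinAt) fun x hx ↦ ?_
  exact christoffel_apply D hx a b

end Bridge

/-! ### Transfer of the structure and the curvature to a chart -/

section CoordinateData

open Filter Topology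

variable {E : Type*} [NormedAddCommGroup E] [NormedSpace ℝ E] [FiniteDimensional ℝ E]
  {M : Type*} [TopologicalSpace M] [ChartedSpace E M] [IsManifold 𝓘(ℝ, E) ∞ M]

/-- The metric in the preferred chart at `p₀`. -/
noncomputable def coordMetric (g : PseudoRiemannianMetric 𝓘(ℝ, E) M) (p₀ : M) (x : E) :
    E →L[ℝ] E →L[ℝ] ℝ :=
  LinearMap.toContinuousBilinearMap (LinearMap.mk₂ ℝ
    (fun a b ↦ g.val ((extChartAt 𝓘(ℝ, E) p₀).symm x)
      (coordFrame p₀ a ((extChartAt 𝓘(ℝ, E) p₀).symm x))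
      (coordFrame p₀ b ((extChartAt 𝓘(ℝ, E) p₀).symm x)))
    (fun a a' b ↦ by simp only [coordFrame, map_add, add_apply])
    (fun r a b ↦ by simp only [coordFrame, map_smul, smul_apply])
    (fun a b b' ↦ by simp only [coordFrame, map_add])
    (fun r a b ↦ by simp only [coordFrame, map_smul]))

/-- A field of endomorphisms in the preferred chart at `p₀`. -/
noncomputable def coordEndomorphism
    (J : Π q : M, TangentSpace 𝓘(ℝ, E) q →L[ℝ] TangentSpace 𝓘(ℝ, E) q) (p₀ : M) (x : E) :
    E →L[ℝ] E :=
  ((trivializationAt E (TangentSpace 𝓘(ℝ, E) : M → Type _) p₀).continuousLinearMapAt ℝ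
    ((extChartAt 𝓘(ℝ, E) p₀).symm x)).comp ((J ((extChartAt 𝓘(ℝ, E) p₀).symm x)).comp
      ((trivializationAt E (TangentSpace 𝓘(ℝ, E) : M → Type _) p₀).symmL ℝ
        ((extChartAt 𝓘(ℝ, E) p₀).symm x)))

/-- A 1-form in the preferred chart at `p₀`. -/
noncomputable def coordForm (η : Π q : M, TangentSpace 𝓘(ℝ, E) q →L[ℝ] ℝ) (p₀ : M) (x : E) :
    E →L[ℝ] ℝ :=
  (η ((extChartAt 𝓘(ℝ, E) p₀).symm x)).comp
    ((trivializationAt E (TangentSpace 𝓘(ℝ, E) : M → Type _) p₀).symmL ℝ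
        ((extChartAt 𝓘(ℝ, E) p₀).symm x))

theorem coordMetric_apply (g : PseudoRiemannianMetric 𝓘(ℝ, E) M) (p₀ : M) (x a b : E) :
    coordMetric g p₀ x a b = g.val ((extChartAt 𝓘(ℝ, E) p₀).symm x)
      (coordFrame p₀ a ((extChartAt 𝓘(ℝ, E) p₀).symm x))
      (coordFrame p₀ b ((extChartAt 𝓘(ℝ, E) p₀).symm x)) := rfl

omit [FiniteDimensional ℝ E] in
theorem coordFrame_coordEndomorphism {p₀ : M} {x : E} (hx : x ∈ (extChartAt 𝓘(ℝ, E) p₀).target)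
    (J : Π q : M, TangentSpace 𝓘(ℝ, E) q →L[ℝ] TangentSpace 𝓘(ℝ, E) q) (a : E) :
    coordFrame p₀ (coordEndomorphism J p₀ x a) ((extChartAt 𝓘(ℝ, E) p₀).symm x) =
      J ((extChartAt 𝓘(ℝ, E) p₀).symm x)
        (coordFrame p₀ a ((extChartAt 𝓘(ℝ, E) p₀).symm x)) :=
  coordFrame_coordRepr (mem_source_of_mem_target hx) fun q ↦ J q (coordFrame p₀ a q)

theorem coordFrame_christoffel (D : CovariantDerivative 𝓘(ℝ, E) E (TangentSpace 𝓘(ℝ, E) : M → Type _))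
    {p₀ : M} {x : E} (hx : x ∈ (extChartAt 𝓘(ℝ, E) p₀).target) (a b : E) :
    coordFrame p₀ (christoffel D p₀ x a b) ((extChartAt 𝓘(ℝ, E) p₀).symm x) =
      D (coordFrame p₀ b) ((extChartAt 𝓘(ℝ, E) p₀).symm x)
        (coordFrame p₀ a ((extChartAt 𝓘(ℝ, E) p₀).symm x)) := by
  rw [christoffel_apply D hx]
  exact coordFrame_coordRepr (mem_source_of_mem_target hx)
    fun q ↦ D (coordFrame p₀ b) q (coordFrame p₀ a q)

omit [FiniteDimensional ℝ E] in
theorem coordFrame_injective {p₀ q : M} (hq : q ∈ (chartAt E p₀).source) {a b : E}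
    (h : coordFrame p₀ a q = coordFrame p₀ b q) : a = b := by
  rw [← coordRepr_coordFrame hq a, ← coordRepr_coordFrame hq b, coordRepr, coordRepr, h]

omit [FiniteDimensional ℝ E] in
theorem exists_coordFrame_eq {p₀ q : M} (hq : q ∈ (chartAt E p₀).source)
    (u : TangentSpace 𝓘(ℝ, E) q) : ∃ a, coordFrame p₀ a q = u :=
  ⟨_, Trivialization.symmL_continuousLinearMapAt _ (mem_baseSet_of_mem_source hq) u⟩

omit [FiniteDimensional ℝ E] in
theorem contMDiffAt_metric_apply (g : PseudoRiemannianMetric 𝓘(ℝ, E) M)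
    {Y Z : Π q : M, TangentSpace 𝓘(ℝ, E) q} {q : M} (hY : CMDiffAt ∞ (T% Y) q)
    (hZ : CMDiffAt ∞ (T% Z) q) : CMDiffAt ∞ (fun q ↦ g.val q (Y q) (Z q)) q := by
  have : ContMDiffAt 𝓘(ℝ, E) (𝓘(ℝ, E).prod 𝓘(ℝ)) ∞
      (fun m ↦ TotalSpace.mk' ℝ (E := Bundle.Trivial M ℝ) m (g.val m (Y m) (Z m))) q := by
    apply ContMDiffAt.clm_bundle_apply₂ (F₁ := E) (F₂ := E)
    · exact g.contMDiff.contMDiffAt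
    · exact hY
    · exact hZ
  simp only [contMDiffAt_totalSpace] at this
  exact this.2

omit [FiniteDimensional ℝ E] in
theorem contMDiffAt_form_apply {η : Π q : M, TangentSpace 𝓘(ℝ, E) q →L[ℝ] ℝ}
    {Y : Π q : M, TangentSpace 𝓘(ℝ, E) q} {q : M}
    (hη : ContMDiffAt 𝓘(ℝ, E) (𝓘(ℝ, E).prod 𝓘(ℝ, E →L[ℝ] ℝ)) ∞
        (fun p ↦ TotalSpace.mk' (E →L[ℝ] ℝ)
          (E := fun p : M ↦ TangentSpace 𝓘(ℝ, E) p →L[ℝ] ℝ) p (η p)) q)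
    (hY : CMDiffAt ∞ (T% Y) q) : CMDiffAt ∞ (fun q ↦ η q (Y q)) q := by
  have : ContMDiffAt 𝓘(ℝ, E) (𝓘(ℝ, E).prod 𝓘(ℝ)) ∞
      (fun m ↦ TotalSpace.mk' ℝ (E := Bundle.Trivial M ℝ) m (η m (Y m))) q := by
    apply ContMDiffAt.clm_bundle_apply (F₁ := E)
    · exact hη
    · exact hY
  simp only [contMDiffAt_totalSpace] at this
  exact this.2

variable [T2Space M]

/-- The data of a quaternionic Kähler manifold in a chart. -/
theorem isCoordQuaternionicKahler
    {D : CovariantDerivative 𝓘(ℝ, E) E (TangentSpace 𝓘(ℝ, E) : M → Type _)}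
    {S : AlmostHypercomplexStructure 𝓘(ℝ, E) M}
    {g : PseudoRiemannianMetric 𝓘(ℝ, E) M} (hg : IsHermitianNorden g S)
    (hD : IsLeviCivita g D) {U : Set M} (hU : IsOpen U)
    {η : Fin 3 → Π p : M, TangentSpace 𝓘(ℝ, E) p →L[ℝ] ℝ}
    (hη : ∀ α, ContMDiffOn 𝓘(ℝ, E) (𝓘(ℝ, E).prod 𝓘(ℝ, E →L[ℝ] ℝ)) ∞
        (fun p ↦ TotalSpace.mk' (E →L[ℝ] ℝ)
          (E := fun p : M ↦ TangentSpace 𝓘(ℝ, E) p →L[ℝ] ℝ) p (η α p)) U)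
    (hQ : ∀ (α : Fin 3), ∀ p ∈ U, ∀ (Y : Π q : M, TangentSpace 𝓘(ℝ, E) q), MDiffAt (T% Y) p →
        ∀ u : TangentSpace 𝓘(ℝ, E) p,
          D (fun q ↦ S.J α q (Y q)) p u - S.J α p (D Y p u) =
            η (α + 2) p u • S.J (α + 1) p (Y p) - η (α + 1) p u • S.J (α + 2) p (Y p))
    (p₀ : M) :
    IsCoordQuaternionicKahler
      ((extChartAt 𝓘(ℝ, E) p₀).target ∩ (extChartAt 𝓘(ℝ, E) p₀).symm ⁻¹' U)
      (coordMetric g p₀) (fun α ↦ coordEndomorphism (S.J α) p₀) (christoffel D p₀)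
      (fun α ↦ coordForm (η α) p₀) := by
  have hJs (α : Fin 3) {q : M} (hq : q ∈ (chartAt E p₀).source) (a : E) :
      CMDiffAt ∞ (T% fun q ↦ S.J α q (coordFrame p₀ a q)) q :=
    ((S.contMDiff α).contMDiffAt).clm_bundle_apply (contMDiffAt_coordFrame hq a)
  have hJc (α : Fin 3) : ContDiffOn ℝ ∞ (coordEndomorphism (S.J α) p₀)
      (extChartAt 𝓘(ℝ, E) p₀).target := by
    refine contDiffOn_clm_apply.mpr fun a x hx ↦ ?_
    have hq := mem_source_of_mem_target hx
    exact (contDiffAt_comp_extChartAt_symm hx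
      ((contMDiffAt_iff_coordRepr hq).mp (hJs α hq a))).contDiffWithinAt
  have hGc : ContDiffOn ℝ ∞ (coordMetric g p₀) (extChartAt 𝓘(ℝ, E) p₀).target := by
    refine contDiffOn_clm_apply.mpr fun a ↦ contDiffOn_clm_apply.mpr fun b x hx ↦ ?_
    have hq := mem_source_of_mem_target hx
    exact (contDiffAt_comp_extChartAt_symm hx (contMDiffAt_metric_apply g
      (contMDiffAt_coordFrame hq a) (contMDiffAt_coordFrame hq b))).contDiffWithinAt
  refine
    { isOpen := (continuousOn_extChartAt_symm p₀).isOpen_inter_preimage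
        (isOpen_extChartAt_target p₀) hU
      contDiffOn_metric := hGc.mono Set.inter_subset_left
      contDiffOn_J := fun α ↦ (hJc α).mono Set.inter_subset_left
      contDiffOn_christoffel := (contDiffOn_christoffel D hD.smooth p₀).mono Set.inter_subset_left
      contDiffOn_form := fun α ↦ ?_
      symm := fun hx u v ↦ g.symm _ _ _
      nondegenerate := fun {x} hx u hu ↦ ?_
      sq := fun α x hx u ↦ ?_
      comp := fun α x hx u ↦ ?_
      comp_neg := fun α x hx u ↦ ?_
      hermitianNorden := fun α x hx u v ↦ ?_
      torsion := fun {x} hx u v ↦ ?_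
      metric := fun {x} hx a u v ↦ ?_
      quaternionic := fun α x hx a u ↦ ?_ }
  · refine contDiffOn_clm_apply.mpr fun a x hx ↦ ?_
    have hq := mem_source_of_mem_target hx.1
    exact (contDiffAt_comp_extChartAt_symm hx.1 (contMDiffAt_form_apply
      ((hη α).contMDiffAt (hU.mem_nhds hx.2)) (contMDiffAt_coordFrame hq a))).contDiffWithinAt
  · have hq := mem_source_of_mem_target hx.1
    refine coordFrame_injective hq ?_
    rw [g.nondegenerate _ (coordFrame p₀ u ((extChartAt 𝓘(ℝ, E) p₀).symm x)) fun v ↦ ?_]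
    · simp only [coordFrame, map_zero]
    · obtain ⟨b, rfl⟩ := exists_coordFrame_eq hq v
      exact hu b
  · refine coordFrame_injective (mem_source_of_mem_target hx.1) ?_
    rw [coordFrame_coordEndomorphism hx.1, coordFrame_coordEndomorphism hx.1, S.sq]
    simp only [coordFrame, map_neg]
  · refine coordFrame_injective (mem_source_of_mem_target hx.1) ?_
    rw [coordFrame_coordEndomorphism hx.1, coordFrame_coordEndomorphism hx.1,
      coordFrame_coordEndomorphism hx.1, S.comp]
  · refine coordFrame_injective (mem_source_of_mem_target hx.1) ?_
    rw [coordFrame_coordEndomorphism hx.1, S.comp_neg, ← coordFrame_coordEndomorphism hx.1,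
      ← coordFrame_coordEndomorphism hx.1]
    simp only [coordFrame, map_neg]
  · simp only [coordMetric_apply]
    rw [coordFrame_coordEndomorphism hx.1, coordFrame_coordEndomorphism hx.1]
    exact hg α _ _ _
  · have hq := mem_source_of_mem_target hx.1
    refine coordFrame_injective hq ?_
    -- Zero torsion and commuting coordinate fields make the Christoffel symbols symmetric.
    rw [coordFrame_christoffel D hx.1, coordFrame_christoffel D hx.1, ← sub_eq_zero,
      (CovariantDerivative.torsion_eq_zero_iff D).mp hD.torsion_eq_zero
      (mdifferentiableAt_coordFrame hq u) (mdifferentiableAt_coordFrame hq v),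
      mlieBracket_coordFrame hq]
  · have hq := mem_source_of_mem_target hx.1
    have h1 : fderiv ℝ (coordMetric g p₀) x a u v =
        fderiv ℝ ((fun q ↦ g.val q (coordFrame p₀ u q) (coordFrame p₀ v q)) ∘
          (extChartAt 𝓘(ℝ, E) p₀).symm) x a := by
      have hd := hGc.differentiableAt_of_isOpen (isOpen_extChartAt_target p₀) hx.1
      have h2 : (fun q ↦ g.val q (coordFrame p₀ u q) (coordFrame p₀ v q)) ∘
          (extChartAt 𝓘(ℝ, E) p₀).symm = fun y ↦ coordMetric g p₀ y u v := rfl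
      rw [h2, fderiv_clm_apply (hd.clm_apply (differentiableAt_const _)) (differentiableAt_const _),
        fderiv_clm_apply hd (differentiableAt_const _)]
      simp
    rw [h1, ← mvfderiv_coordFrame hx.1 ((contMDiffAt_metric_apply g (contMDiffAt_coordFrame hq u)
      (contMDiffAt_coordFrame hq v)).mdifferentiableAt (by simp)),
      hD.metric _ _ _ (mdifferentiableAt_coordFrame hq u) (mdifferentiableAt_coordFrame hq v),
      coordMetric_apply, coordMetric_apply, coordFrame_christoffel D hx.1,
      coordFrame_christoffel D hx.1]
  · have hq := mem_source_of_mem_target hx.1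
    have h1 := coordRepr_covariantDerivative D hx.1
      ((hJs α hq u).mdifferentiableAt (by simp)) a
    have h2 : coordRepr p₀ (fun q ↦ S.J α q (coordFrame p₀ u q)) ∘ (extChartAt 𝓘(ℝ, E) p₀).symm =
      fun y ↦ coordEndomorphism (S.J α) p₀ y u := rfl
    have hd := (hJc α).differentiableAt_of_isOpen (isOpen_extChartAt_target p₀) hx.1
    have h3 : fderiv ℝ (coordEndomorphism (S.J α) p₀) x a u +
        christoffel D p₀ x a (coordEndomorphism (S.J α) p₀ x u) =
        coordCovDeriv (christoffel D p₀) (fun y ↦ coordEndomorphism (S.J α) p₀ y u) x a := by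
      rw [coordCovDeriv, fderiv_clm_apply hd (differentiableAt_const _)]
      simp
    rw [h3, ← h2, ← h1]
    refine coordFrame_injective hq ?_
    have h4 := hQ α _ hx.2 (coordFrame p₀ u) (mdifferentiableAt_coordFrame hq u)
      (coordFrame p₀ a ((extChartAt 𝓘(ℝ, E) p₀).symm x))
    have hsub (a b : E) : coordFrame p₀ (a - b) ((extChartAt 𝓘(ℝ, E) p₀).symm x) =
        coordFrame p₀ a ((extChartAt 𝓘(ℝ, E) p₀).symm x) -
          coordFrame p₀ b ((extChartAt 𝓘(ℝ, E) p₀).symm x) := map_sub _ _ _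
    have hsmul (r : ℝ) (b : E) : coordFrame p₀ (r • b) ((extChartAt 𝓘(ℝ, E) p₀).symm x) =
        r • coordFrame p₀ b ((extChartAt 𝓘(ℝ, E) p₀).symm x) := map_smul _ _ _
    rw [hsub, hsub, hsmul, hsmul, coordFrame_coordEndomorphism hx.1,
      coordFrame_coordEndomorphism hx.1, coordFrame_coordEndomorphism hx.1,
      coordFrame_christoffel D hx.1]
    refine Eq.trans ?_ h4
    congr 1
    exact coordFrame_coordRepr hq fun q ↦ D (fun q ↦ S.J α q (coordFrame p₀ u q)) q
      (coordFrame p₀ a q)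

/-- The curvature at `p` in the preferred chart at `p`. -/
theorem continuousLinearMapAt_curvature
    {D : CovariantDerivative 𝓘(ℝ, E) E (TangentSpace 𝓘(ℝ, E) : M → Type _)}
    (hD : ContMDiffCovariantDerivativeOn E ∞ D.toFun Set.univ) (p : M)
    (u v w : TangentSpace 𝓘(ℝ, E) p) :
    letI A := (trivializationAt E (TangentSpace 𝓘(ℝ, E) : M → Type _) p).continuousLinearMapAt ℝ p
    A (curvature D p u v w) = coordCurvature (christoffel D p) (extChartAt 𝓘(ℝ, E) p p)
      (A u) (A v) (A w) := by
  set A := (trivializationAt E (TangentSpace 𝓘(ℝ, E) : M → Type _) p).continuousLinearMapAt ℝ p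
    with hA
  have hp : p ∈ (chartAt E p).source := mem_chart_source E p
  have hx : extChartAt 𝓘(ℝ, E) p p ∈ (extChartAt 𝓘(ℝ, E) p).target := mem_extChartAt_target p
  have hxp : (extChartAt 𝓘(ℝ, E) p).symm (extChartAt 𝓘(ℝ, E) p p) = p := extChartAt_to_inv p
  have hnear : ∀ᶠ q in 𝓝 p, q ∈ (chartAt E p).source := (chartAt E p).open_source.mem_nhds hp
  have hext (u : TangentSpace 𝓘(ℝ, E) p) :
      ∀ᶠ q in 𝓝 p, FiberBundle.extend E u q = coordFrame p (A u) q :=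
    hnear.mono fun q hq ↦ extend_eq_coordFrame hq u
  have hextD (u : TangentSpace 𝓘(ℝ, E) p) :
      ∀ᶠ q in 𝓝 p, D (fun m ↦ FiberBundle.extend E u m) q = D (coordFrame p (A u)) q := by
    filter_upwards [(hext u).eventually_nhds, hnear] with q hq hqs
    exact D.isCovariantDerivativeOn.congr_of_eventuallyEq
      (mdifferentiableAt_congr_section (hq.mono fun _ h ↦ h.symm)
        (mdifferentiableAt_coordFrame hqs _))
      (mdifferentiableAt_coordFrame hqs _) Filter.univ_mem hq
  have hW (b c : E) : MDiffAt (T% fun q ↦ D (coordFrame p c) q (coordFrame p b q)) p :=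
    (((contMDiffAt_covariantDerivative_coordFrame D hD hp c).clm_bundle_apply
      (contMDiffAt_coordFrame hp b))).mdifferentiableAt (by simp)
  have hsecond (u v w : TangentSpace 𝓘(ℝ, E) p) :
      A (D (fun q ↦ D (fun m ↦ FiberBundle.extend E w m) q (FiberBundle.extend E v q)) p u) =
      coordCovDeriv (christoffel D p) (fun y ↦ christoffel D p y (A v) (A w))
        (extChartAt 𝓘(ℝ, E) p p) (A u) := by
    have h1 : ∀ᶠ q in 𝓝 p,
        D (fun m ↦ FiberBundle.extend E w m) q (FiberBundle.extend E v q) =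
        D (coordFrame p (A w)) q (coordFrame p (A v) q) := by
      filter_upwards [hextD w, hext v] with q h1 h2
      rw [h1, h2]
    rw [D.isCovariantDerivativeOn.congr_of_eventuallyEq
      (mdifferentiableAt_congr_section (h1.mono fun _ h ↦ h.symm) (hW _ _))
      (hW _ _) Filter.univ_mem h1]
    have h2 := coordRepr_covariantDerivative D hx
      (Z := fun q ↦ D (coordFrame p (A w)) q (coordFrame p (A v) q)) (by rw [hxp]; exact hW _ _)
      (A u)
    rw [hxp] at h2
    have h3 : coordFrame p (A u) p = u :=
      Trivialization.symmL_continuousLinearMapAt _ (mem_baseSet_of_mem_source hp) u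
    rw [coordRepr, h3] at h2
    rw [hA, h2]
    refine coordCovDeriv_congr _ ?_ _
    filter_upwards [(isOpen_extChartAt_target p).mem_nhds hx] with y hy
    exact (christoffel_apply D hy _ _).symm
  have hbr : VectorField.mlieBracket 𝓘(ℝ, E) (fun m ↦ FiberBundle.extend E u m)
      (fun m ↦ FiberBundle.extend E v m) p = 0 := by
    rw [Filter.EventuallyEq.mlieBracket_vectorField_eq (hext u) (hext v),
      mlieBracket_coordFrame hp]
  have hcurv : curvature D p u v w =
      D (fun q ↦ D (fun m ↦ FiberBundle.extend E w m) q (FiberBundle.extend E v q)) p u -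
      D (fun q ↦ D (fun m ↦ FiberBundle.extend E w m) q (FiberBundle.extend E u q)) p v := by
    simp only [curvature]
    rw [hbr, map_zero, sub_zero, FiberBundle.extend_apply_self, FiberBundle.extend_apply_self]
  rw [hcurv, map_sub, hsecond, hsecond]
  have hΓ := (contDiffOn_christoffel D hD p).differentiableAt_of_isOpen
    (isOpen_extChartAt_target p) hx
  have h5 := coordCovDeriv_comm hΓ (z := fun _ ↦ A w) contDiffAt_const (A u) (A v)
  simp only [coordCovDeriv_const] at h5
  exact h5

end CoordinateData

/-! ### A chart-independent exterior derivative of 1-forms -/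

section ExteriorDerivative

variable {E : Type*} [NormedAddCommGroup E] [NormedSpace ℝ E]
  {M : Type*} [TopologicalSpace M] [ChartedSpace E M] [IsManifold 𝓘(ℝ, E) ∞ M]

/-- The operation `X (η Y) - Y (η X) - η [X, Y]` on vector fields. -/
noncomputable def exteriorDerivativeAux (η : Π q : M, TangentSpace 𝓘(ℝ, E) q →L[ℝ] ℝ) (p : M)
    (X Y : Π q : M, TangentSpace 𝓘(ℝ, E) q) : ℝ :=
  mvfderiv 𝓘(ℝ, E) (fun q ↦ η q (Y q)) p (X p) - mvfderiv 𝓘(ℝ, E) (fun q ↦ η q (X q)) p (Y p) -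
    η p (VectorField.mlieBracket 𝓘(ℝ, E) X Y p)

/-- The exterior derivative of a 1-form. -/
noncomputable def exteriorDerivative (η : Π q : M, TangentSpace 𝓘(ℝ, E) q →L[ℝ] ℝ) (p : M)
    (u v : TangentSpace 𝓘(ℝ, E) p) : ℝ :=
  exteriorDerivativeAux η p (FiberBundle.extend E u) (FiberBundle.extend E v)

theorem mdifferentiableAt_form_apply {η : Π q : M, TangentSpace 𝓘(ℝ, E) q →L[ℝ] ℝ}
    {Y : Π q : M, TangentSpace 𝓘(ℝ, E) q} {q : M}
    (hη : MDifferentiableAt 𝓘(ℝ, E) (𝓘(ℝ, E).prod 𝓘(ℝ, E →L[ℝ] ℝ))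
        (fun p ↦ TotalSpace.mk' (E →L[ℝ] ℝ)
          (E := fun p : M ↦ TangentSpace 𝓘(ℝ, E) p →L[ℝ] ℝ) p (η p)) q)
    (hY : MDiffAt (T% Y) q) : MDiffAt (fun q ↦ η q (Y q)) q := by
  have : MDifferentiableAt 𝓘(ℝ, E) (𝓘(ℝ, E).prod 𝓘(ℝ))
      (fun m ↦ TotalSpace.mk' ℝ (E := Bundle.Trivial M ℝ) m (η m (Y m))) q := by
    apply MDifferentiableAt.clm_bundle_apply (F₁ := E)
    · exact hη
    · exact hY
  simp only [mdifferentiableAt_totalSpace] at this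
  exact this.2

omit [IsManifold 𝓘(ℝ, E) ∞ M] in
theorem exteriorDerivativeAux_swap (η : Π q : M, TangentSpace 𝓘(ℝ, E) q →L[ℝ] ℝ) (p : M)
    (X Y : Π q : M, TangentSpace 𝓘(ℝ, E) q) :
    exteriorDerivativeAux η p X Y = -exteriorDerivativeAux η p Y X := by
  rw [exteriorDerivativeAux, exteriorDerivativeAux, VectorField.mlieBracket_swap, Pi.neg_apply,
    map_neg]
  ring

/-- The term (Y f) η(X) from differentiating η(f X) cancels against the one from [f X, Y]. -/
theorem exteriorDerivativeAux_tensorial_left [CompleteSpace E]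
    {η : Π q : M, TangentSpace 𝓘(ℝ, E) q →L[ℝ] ℝ}
    {p : M} (hη : MDifferentiableAt 𝓘(ℝ, E) (𝓘(ℝ, E).prod 𝓘(ℝ, E →L[ℝ] ℝ))
        (fun p ↦ TotalSpace.mk' (E →L[ℝ] ℝ)
          (E := fun p : M ↦ TangentSpace 𝓘(ℝ, E) p →L[ℝ] ℝ) p (η p)) p)
    (Y : Π q : M, TangentSpace 𝓘(ℝ, E) q) :
    TensorialAt 𝓘(ℝ, E) E (exteriorDerivativeAux η p · Y) p where
  smul {f X} hf hX := by
    have h : (fun q ↦ η q ((f • X) q)) = f * fun q ↦ η q (X q) := by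
      ext q
      simp
    rw [exteriorDerivativeAux, exteriorDerivativeAux, h,
      mvfderiv_mul hf (mdifferentiableAt_form_apply hη hX), VectorField.mlieBracket_smul_left hf hX]
    simp
    ring
  add {X X'} hX hX' := by
    have h : (fun q ↦ η q ((X + X') q)) = (fun q ↦ η q (X q)) + fun q ↦ η q (X' q) := by
      ext q
      simp
    rw [exteriorDerivativeAux, exteriorDerivativeAux, exteriorDerivativeAux, h,
      mvfderiv_add (mdifferentiableAt_form_apply hη hX) (mdifferentiableAt_form_apply hη hX'),
      VectorField.mlieBracket_add_left hX hX']
    simp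
    ring

theorem exteriorDerivativeAux_tensorial_right [CompleteSpace E]
    {η : Π q : M, TangentSpace 𝓘(ℝ, E) q →L[ℝ] ℝ}
    {p : M} (hη : MDifferentiableAt 𝓘(ℝ, E) (𝓘(ℝ, E).prod 𝓘(ℝ, E →L[ℝ] ℝ))
        (fun p ↦ TotalSpace.mk' (E →L[ℝ] ℝ)
          (E := fun p : M ↦ TangentSpace 𝓘(ℝ, E) p →L[ℝ] ℝ) p (η p)) p)
    (X : Π q : M, TangentSpace 𝓘(ℝ, E) q) :
    TensorialAt 𝓘(ℝ, E) E (exteriorDerivativeAux η p X ·) p where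
  smul hf hY := by
    simp only [exteriorDerivativeAux_swap η p X]
    rw [(exteriorDerivativeAux_tensorial_left hη X).smul hf hY, smul_neg]
  add hY hY' := by
    simp only [exteriorDerivativeAux_swap η p X]
    rw [(exteriorDerivativeAux_tensorial_left hη X).add hY hY', neg_add]

/-- Tensoriality replaces the extensions by coordinate fields of any chart, whose bracket vanishes.
This lets factors μ found in charts centred at different points be compared in a single chart. -/
theorem exteriorDerivative_coordFrame [FiniteDimensional ℝ E]
    {η : Π q : M, TangentSpace 𝓘(ℝ, E) q →L[ℝ] ℝ} {p₀ : M} {x : E}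
    (hx : x ∈ (extChartAt 𝓘(ℝ, E) p₀).target)
    (hη : MDifferentiableAt 𝓘(ℝ, E) (𝓘(ℝ, E).prod 𝓘(ℝ, E →L[ℝ] ℝ))
        (fun p ↦ TotalSpace.mk' (E →L[ℝ] ℝ)
          (E := fun p : M ↦ TangentSpace 𝓘(ℝ, E) p →L[ℝ] ℝ) p (η p))
          ((extChartAt 𝓘(ℝ, E) p₀).symm x))
    (hd : DifferentiableAt ℝ (coordForm η p₀) x) (a b : E) :
    exteriorDerivative η ((extChartAt 𝓘(ℝ, E) p₀).symm x)
      (coordFrame p₀ a ((extChartAt 𝓘(ℝ, E) p₀).symm x))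
      (coordFrame p₀ b ((extChartAt 𝓘(ℝ, E) p₀).symm x)) =
      fderiv ℝ (coordForm η p₀) x a b - fderiv ℝ (coordForm η p₀) x b a := by
  have hq := mem_source_of_mem_target hx
  have : CompleteSpace E := FiniteDimensional.complete ℝ E
  have hF (a b : E) : mvfderiv 𝓘(ℝ, E) (fun q ↦ η q (coordFrame p₀ b q))
      ((extChartAt 𝓘(ℝ, E) p₀).symm x) (coordFrame p₀ a ((extChartAt 𝓘(ℝ, E) p₀).symm x)) =
      fderiv ℝ (coordForm η p₀) x a b := by
    rw [mvfderiv_coordFrame hx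
      (mdifferentiableAt_form_apply hη (mdifferentiableAt_coordFrame hq b))]
    change fderiv ℝ (fun y ↦ coordForm η p₀ y b) x a = _
    rw [fderiv_clm_apply hd (differentiableAt_const _)]
    simp
  rw [exteriorDerivative, TensorialAt.pointwise₂ (Φ := exteriorDerivativeAux η _)
    (fun Y _ ↦ exteriorDerivativeAux_tensorial_left hη Y)
    (fun X _ ↦ exteriorDerivativeAux_tensorial_right hη X)
    (FiberBundle.mdifferentiableAt_extend ..) (mdifferentiableAt_coordFrame hq a)
    (FiberBundle.mdifferentiableAt_extend ..) (mdifferentiableAt_coordFrame hq b)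
    (FiberBundle.extend_apply_self ..) (FiberBundle.extend_apply_self ..),
    exteriorDerivativeAux, mlieBracket_coordFrame hq, map_zero, sub_zero, hF, hF]

end ExteriorDerivative

/-! ### The Einstein condition on the manifold -/

section Einstein

open Filter Topology

variable {E : Type*} [NormedAddCommGroup E] [NormedSpace ℝ E] [FiniteDimensional ℝ E]
  {M : Type*} [TopologicalSpace M] [ChartedSpace E M] [IsManifold 𝓘(ℝ, E) ∞ M]

theorem metric_eq_coordMetric (g : PseudoRiemannianMetric 𝓘(ℝ, E) M) (p : M)
    (y z : TangentSpace 𝓘(ℝ, E) p) :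
    letI A := (trivializationAt E (TangentSpace 𝓘(ℝ, E) : M → Type _) p).continuousLinearMapAt ℝ p
    g.val p y z = coordMetric g p (extChartAt 𝓘(ℝ, E) p p) (A y) (A z) := by
  have h (q : M) (hq : q ∈ (chartAt E p).source) (y : TangentSpace 𝓘(ℝ, E) q) : coordFrame p
      ((trivializationAt E (TangentSpace 𝓘(ℝ, E) : M → Type _) p).continuousLinearMapAt ℝ q y) q =
        y := Trivialization.symmL_continuousLinearMapAt _ (mem_baseSet_of_mem_source hq) y
  -- The base point of `coordMetric` is the chart image of p mapped back, equal to p only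
  -- propositionally; a variable q allows substitution in the dependent types.
  have key : ∀ q, q = p → ∀ y z : TangentSpace 𝓘(ℝ, E) p, g.val p y z = g.val q
      (coordFrame p ((trivializationAt E (TangentSpace 𝓘(ℝ, E) : M → Type _) p).continuousLinearMapAt
        ℝ p y) q)
      (coordFrame p ((trivializationAt E (TangentSpace 𝓘(ℝ, E) : M → Type _) p).continuousLinearMapAt
        ℝ p z) q) := by
    rintro q rfl y z
    rw [h _ (mem_chart_source E q), h _ (mem_chart_source E q)]
  exact key _ (extChartAt_to_inv p) y z

/-- The Ricci tensor as a trace in the preferred chart. -/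
theorem ricci_eq_trace [T2Space M] (g : PseudoRiemannianMetric 𝓘(ℝ, E) M)
    {D : CovariantDerivative 𝓘(ℝ, E) E (TangentSpace 𝓘(ℝ, E) : M → Type _)}
    (hD : ContMDiffCovariantDerivativeOn E ∞ D.toFun Set.univ) (p : M)
    (y z : TangentSpace 𝓘(ℝ, E) p) :
    letI A := (trivializationAt E (TangentSpace 𝓘(ℝ, E) : M → Type _) p).continuousLinearMapAt ℝ p
    ricci g D p y z = LinearMap.trace ℝ E
      (((coordCurvature (christoffel D p) (extChartAt 𝓘(ℝ, E) p p)).flip (A y)).flip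
        (A z)).toLinearMap := by
  set e := (trivializationAt E (TangentSpace 𝓘(ℝ, E) : M → Type _) p).continuousLinearEquivAt ℝ p
    (mem_baseSet_of_mem_source (mem_chart_source E p)) 
  have heA (u : TangentSpace 𝓘(ℝ, E) p) : (trivializationAt E (TangentSpace 𝓘(ℝ, E) : M → Type _)
      p).continuousLinearMapAt ℝ p u = e u :=
    congrFun (Trivialization.coe_continuousLinearEquivAt_eq _
      (mem_baseSet_of_mem_source (mem_chart_source E p))).symm u
  simp only [heA]
  set T : E →ₗ[ℝ] E := (((coordCurvature (christoffel D p) (extChartAt 𝓘(ℝ, E) p p)).flip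
    (e y)).flip (e z)).toLinearMap with hT
  have : FiniteDimensional ℝ (TangentSpace 𝓘(ℝ, E) p) := inferInstanceAs (FiniteDimensional ℝ E)
  have hcurv (u : TangentSpace 𝓘(ℝ, E) p) :
      curvature D p u y z = e.symm.toLinearEquiv.conj T u := by
    apply e.injective
    have h1 := continuousLinearMapAt_curvature hD p u y z
    have h2 : e (e.symm.toLinearEquiv.conj T u) = T (e u) := by
      simp [LinearEquiv.conj_apply]
    rw [h2]
    simp only [heA] at h1
    exact h1
  have h3 := sum_gram_inv_mul_eq_trace (Module.finBasis ℝ (TangentSpace 𝓘(ℝ, E) p))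
    ((ContinuousLinearMap.coeLM ℝ).comp (g.val p).toLinearMap) (g.symm p) (g.nondegenerate p)
    (e.symm.toLinearEquiv.conj T)
  rw [LinearMap.trace_conj'] at h3
  refine Eq.trans ?_ h3
  simp only [ricci, hcurv]
  rfl

section

variable [T2Space M] {D : CovariantDerivative 𝓘(ℝ, E) E (TangentSpace 𝓘(ℝ, E) : M → Type _)}
    {S : AlmostHypercomplexStructure 𝓘(ℝ, E) M}
    {g : PseudoRiemannianMetric 𝓘(ℝ, E) M} (hdim : 8 ≤ Module.finrank ℝ E)
    (hg : IsHermitianNorden g S)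
    (hD : IsLeviCivita g D) {U : Set M} (hU : IsOpen U)
    {η : Fin 3 → Π p : M, TangentSpace 𝓘(ℝ, E) p →L[ℝ] ℝ}
    (hη : ∀ α, ContMDiffOn 𝓘(ℝ, E) (𝓘(ℝ, E).prod 𝓘(ℝ, E →L[ℝ] ℝ)) ∞
        (fun p ↦ TotalSpace.mk' (E →L[ℝ] ℝ)
          (E := fun p : M ↦ TangentSpace 𝓘(ℝ, E) p →L[ℝ] ℝ) p (η α p)) U)
    (hQ : ∀ (α : Fin 3), ∀ p ∈ U, ∀ (Y : Π q : M, TangentSpace 𝓘(ℝ, E) q), MDiffAt (T% Y) p →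
        ∀ u : TangentSpace 𝓘(ℝ, E) p,
          D (fun q ↦ S.J α q (Y q)) p u - S.J α p (D Y p u) =
            η (α + 2) p u • S.J (α + 1) p (Y p) - η (α + 1) p u • S.J (α + 2) p (Y p))
include hdim hg hD hU hη hQ

/-- At each point the exterior derivative of `η 0` is a multiple of the fundamental form of
`S.J 0`, and the Ricci tensor is the corresponding multiple of the metric. -/
theorem exists_ricci_eq_and_exteriorDerivative_eq {p : M} (hp : p ∈ U) :
    ∃ μ : ℝ, (∀ u v, exteriorDerivative (η 0) p u v = μ * g.val p (S.J 0 p u) v) ∧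
      ∀ y z, ricci g D p y z = -(Module.finrank ℝ E / 4 : ℝ) * μ * g.val p y z := by
  have hQK := isCoordQuaternionicKahler hg hD hU hη hQ p
  have hxp : (extChartAt 𝓘(ℝ, E) p).symm (extChartAt 𝓘(ℝ, E) p p) = p := extChartAt_to_inv p
  have hx : extChartAt 𝓘(ℝ, E) p p ∈ (extChartAt 𝓘(ℝ, E) p).target := mem_extChartAt_target p
  have hs : extChartAt 𝓘(ℝ, E) p p ∈
      (extChartAt 𝓘(ℝ, E) p).target ∩ (extChartAt 𝓘(ℝ, E) p).symm ⁻¹' U :=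
    ⟨hx, by rw [Set.mem_preimage, hxp]; exact hp⟩
  obtain ⟨μ, h1, h2⟩ := hQK.exists_trace_curvature hdim hs
  refine ⟨μ, ?_, fun y z ↦ ?_⟩
  · suffices h : ∀ u v : TangentSpace 𝓘(ℝ, E)
        ((extChartAt 𝓘(ℝ, E) p).symm (extChartAt 𝓘(ℝ, E) p p)),
        exteriorDerivative (η 0) _ u v = μ * g.val _ (S.J 0 _ u) v by
      rwa [hxp] at h
    intro u v
    obtain ⟨a, rfl⟩ := exists_coordFrame_eq (mem_source_of_mem_target hx) u
    obtain ⟨b, rfl⟩ := exists_coordFrame_eq (mem_source_of_mem_target hx) v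
    rw [exteriorDerivative_coordFrame hx
      (((hη 0).contMDiffAt (hU.mem_nhds hs.2)).mdifferentiableAt (by simp))
      ((hQK.contDiffOn_form 0).differentiableAt_of_isOpen hQK.isOpen hs), h1, coordMetric_apply,
      coordFrame_coordEndomorphism hx]
  · rw [ricci_eq_trace g hD.smooth p y z, metric_eq_coordMetric g p y z]
    exact h2 _ _ _ fun a ↦ rfl

/-- **Schur's lemma** for the factor between the exterior derivative of `η 0` and the fundamental
form of `S.J 0`. -/
theorem eventually_eq_of_exteriorDerivative_eq {μ : M → ℝ} (hμ : ∀ p ∈ U, ∀ u v,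
    exteriorDerivative (η 0) p u v = μ p * g.val p (S.J 0 p u) v) {p : M} (hp : p ∈ U) :
    ∀ᶠ q in 𝓝 p, μ q = μ p := by
  have hQK := isCoordQuaternionicKahler hg hD hU hη hQ p
  have hxp : (extChartAt 𝓘(ℝ, E) p).symm (extChartAt 𝓘(ℝ, E) p p) = p := extChartAt_to_inv p
  have hx : extChartAt 𝓘(ℝ, E) p p ∈ (extChartAt 𝓘(ℝ, E) p).target := mem_extChartAt_target p
  have hs : extChartAt 𝓘(ℝ, E) p p ∈
      (extChartAt 𝓘(ℝ, E) p).target ∩ (extChartAt 𝓘(ℝ, E) p).symm ⁻¹' U :=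
    ⟨hx, by rw [Set.mem_preimage, hxp]; exact hp⟩
  -- The function μ is read in the one chart at p, where the coordinate Schur lemma applies.
  have h := hQK.eventually_eq_of_exteriorDerivative_eq
    (μ := μ ∘ (extChartAt 𝓘(ℝ, E) p).symm) hdim (fun x hx a b ↦ ?_) hs
  · have h1 := (continuousAt_extChartAt (I := 𝓘(ℝ, E)) p).eventually h
    filter_upwards [h1, extChartAt_source_mem_nhds (I := 𝓘(ℝ, E)) p] with q hq hqs
    rwa [Function.comp_apply, Function.comp_apply, (extChartAt 𝓘(ℝ, E) p).left_inv hqs, hxp] at hq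
  · rw [← exteriorDerivative_coordFrame hx.1
      (((hη 0).contMDiffAt (hU.mem_nhds hx.2)).mdifferentiableAt (by simp))
      ((hQK.contDiffOn_form 0).differentiableAt_of_isOpen hQK.isOpen hx), hμ _ hx.2,
      coordMetric_apply, coordFrame_coordEndomorphism hx.1]
    rfl

end

/-- A quaternionic Kähler manifold of dimension at least 8 with Hermitian-Norden metrics is
Einstein. -/
theorem exists_isLocallyConstant_ricci_eq [T2Space M]
    {D : CovariantDerivative 𝓘(ℝ, E) E (TangentSpace 𝓘(ℝ, E) : M → Type _)}
    {S : AlmostHypercomplexStructure 𝓘(ℝ, E) M}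
    {g : PseudoRiemannianMetric 𝓘(ℝ, E) M} (hdim : 8 ≤ Module.finrank ℝ E)
    (hg : IsHermitianNorden g S) (hD : IsLeviCivita g D) (hQ : IsQuaternionicKahler D S) :
    ∃ c : M → ℝ, IsLocallyConstant c ∧
      ∀ (p : M) (y z : TangentSpace 𝓘(ℝ, E) p), ricci g D p y z = c p * g.val p y z := by
  have hex (p : M) : ∃ c : ℝ, ∀ y z, ricci g D p y z = c * g.val p y z := by
    obtain ⟨U, hU, hp, η, hη, h⟩ := hQ p
    obtain ⟨μ, -, hμ⟩ := exists_ricci_eq_and_exteriorDerivative_eq hdim hg hD hU hη h hp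
    exact ⟨_, hμ⟩
  choose c hc using hex
  refine ⟨c, (IsLocallyConstant.iff_eventually_eq c).mpr fun p ↦ ?_, hc⟩
  -- A nonzero value of `g` makes the Einstein factor unique, so the global c agrees on U with -N μ,
  -- although μ depends on the local 1-forms.
  have hne (q : M) : ∃ u v : TangentSpace 𝓘(ℝ, E) q, g.val q u v ≠ 0 := by
    have : Nontrivial (TangentSpace 𝓘(ℝ, E) q) :=
      Module.nontrivial_of_finrank_pos (R := ℝ) (M := E) (by omega)
    obtain ⟨u, hu⟩ := exists_ne (0 : TangentSpace 𝓘(ℝ, E) q)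
    by_contra! h
    exact hu (g.nondegenerate q u (h u))
  obtain ⟨U, hU, hp, η, hη, h⟩ := hQ p
  have hμ (q : M) : ∃ μ : ℝ, q ∈ U →
      (∀ u v, exteriorDerivative (η 0) q u v = μ * g.val q (S.J 0 q u) v) ∧
      ∀ y z, ricci g D q y z = -(Module.finrank ℝ E / 4 : ℝ) * μ * g.val q y z := by
    by_cases hq : q ∈ U
    · obtain ⟨μ, hμ⟩ := exists_ricci_eq_and_exteriorDerivative_eq hdim hg hD hU hη h hq
      exact ⟨μ, fun _ ↦ hμ⟩
    · exact ⟨0, fun h ↦ absurd h hq⟩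
  choose μ hμ using hμ
  have hcμ (q : M) (hq : q ∈ U) : c q = -(Module.finrank ℝ E / 4 : ℝ) * μ q := by
    obtain ⟨u, v, huv⟩ := hne q
    exact mul_right_cancel₀ huv ((hc q u v).symm.trans ((hμ q hq).2 u v))
  filter_upwards [eventually_eq_of_exteriorDerivative_eq hdim hg hD hU hη h
    (fun q hq ↦ (hμ q hq).1) hp, hU.mem_nhds hp] with q hq hqU
  rw [hcμ q hqU, hcμ p hp, hq]

end Einstein

theorem mainTheorem3 (n : ℕ) (hn : 8 ≤ 4 * n)
    (M : Type*) [TopologicalSpace M] [T2Space M]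
    [ChartedSpace (EuclideanSpace ℝ (Fin (4 * n))) M] [IsManifold (𝓡 (4 * n)) ∞ M]
    (S : AlmostHypercomplexStructure (𝓡 (4 * n)) M)
    (g : PseudoRiemannianMetric (𝓡 (4 * n)) M) (hg : IsHermitianNorden g S)
    (D : CovariantDerivative (𝓡 (4 * n)) (EuclideanSpace ℝ (Fin (4 * n)))
      (TangentSpace (𝓡 (4 * n)) : M → Type _))
    (hD : IsLeviCivita g D) (hQ : IsQuaternionicKahler D S) :
    (∃ c : M → ℝ, IsLocallyConstant c ∧
      ∀ (p : M) (y z : TangentSpace (𝓡 (4 * n)) p), ricci g D p y z = c p * g.val p y z) ∧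
    (PreconnectedSpace M → ∃ c : ℝ,
      ∀ (p : M) (y z : TangentSpace (𝓡 (4 * n)) p), ricci g D p y z = c * g.val p y z) := by
  obtain ⟨c, hc, h⟩ := exists_isLocallyConstant_ricci_eq (by simpa using hn) hg hD hQ
  refine ⟨⟨c, hc, h⟩, fun _ ↦ ?_⟩
  -- A preconnected space may be empty; any constant then works.
  rcases isEmpty_or_nonempty M with hM | ⟨⟨p₀⟩⟩
  · exact ⟨0, fun p ↦ isEmptyElim p⟩
  · exact ⟨c p₀, fun p y z ↦ by rw [h, hc.apply_eq_of_preconnectedSpace p p₀]⟩
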